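/- Let $R$ be a local ring (not necessarily commutative; i.e. with a unique maximal left ideal $\mathfrak m$) such that $\mathfrak m\neq 0$, $\mathfrak m^2=0$ and $\mathfrak m=Rx=xR$ for every $x\in\mathfrak m\setminus\{0\}$. Let $d=R/\mathfrak m$ be its residue skew field, $[r]\in d$ the class of $r\in R$, and $Z(d)$ the center of $d$. For $x\in\mathfrak m\setminus\{0\}$ let $\sigma_x$ be the automorphism of $d$ determined by $\sigma_x([t])=[s]$ whenever $s,t\in R$ and $xt=sx$. Let $\mathcal C$ be either the category of all projective left $R$-modules or the category of finitely generated projective left $R$-modules. A triangulation of $\mathcal C$ means a triangulated structure with translation functor $\Sigma=\mathrm{Id}$: a class of distinguished triangles $X\xrightarrow{u}Y\xrightarrow{v}Z\xrightarrow{w}X$ (with $vu=wv=uw=0$) which (A.1) is closed under isomorphism, contains $X\xrightarrow{\mathrm{id}}X\to0\to X$ for every $X$, and contains a triangle starting with any given morphism $u$; (A.2) contains a triangle if and only if it contains its translate $Y\xrightarrow{v}Z\xrightarrow{w}X\xrightarrow{-u}Y$; (A.3) is such that every pair $(f,g)$ with $gu=u'f$ between distinguished triangles can be completed to a morphism of triangles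 whose mapping cone is distinguished. For $x\in\mathfrak m\setminus\{0\}$ and $r\in d\setminus\{0\}$ let $\triangle^{r}=\triangle^{x,r}$ be the class of triangles of $\mathcal C$ that are isomorphic to a direct sum (a finite one in the finitely generated case) of contractible triangles and of copies of $R\xrightarrow{\cdot x}R\xrightarrow{\cdot x}R\xrightarrow{\cdot \tilde r x}R$, where $\tilde r\in R$ is any lift of $r$. (A triangle is contractible if its identity is homotopic to zero.) Then, for every $x\in\mathfrak m\setminus\{0\}$, every triangulation of $\mathcal C$ equals $\triangle^{r}$ for exactly one $r\in d\setminus\{0\}$, and: (i) (mixed-characteristic case) If $\mathfrak m=2R$, then, taking $x=2$, the map $\triangle^{r}\mapsto r$ is a bijection from the set of triangulations of $\mathcal C$ onto $Z(d)\setminus\{0\}$. (ii) (equicharacteristic case) If $1+1=0$ in $R$, $x\in\mathfrak m\setminus\{0\}$, and $\triangle^{r_x}$ is a fixed triangulation of $\mathcal C$, then the map $\triangle^{r'_x}\mapsto r_x^{-1}r'_x$ is a bijection from the set of triangulations of $\mathcal C$ onto $Z(d)^{\sigma_x}\setminus\{0\}$, where $Z(d)^{\sigma_x}=\{z\in Z(d):\sigma_x(z)=z\}$.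 -/

import Mathlib

universe u

namespace ProjTri

/-! ### Local rings, the residue skew field and the twist `σ_x` -/

section LocalRing

variable (R : Type u) [Ring R]

/-- The maximal ideal `𝔪` of a (not necessarily commutative) local ring, defined as the
intersection of all maximal left ideals; see `isMaximal_iff` for its characterisation as the
unique maximal left ideal of a local ring. -/
abbrev maxIdeal : Ideal R := Ring.jacobson R

variable {R}

theorem mem_maxIdeal_iff [IsLocalRing R] {x : R} : x ∈ maxIdeal R ↔ ¬ IsUnit x := by
  constructor
  · intro hx hu
    have h1 : (1 : R) ∈ maxIdeal R := by
      obtain ⟨v, hv⟩ := hu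
      have := (maxIdeal R).mul_mem_left (↑v⁻¹ : R) hx
      rwa [← hv, Units.inv_mul] at this
    obtain ⟨M, hM⟩ := Ideal.exists_maximal R
    exact hM.ne_top ((Ideal.eq_top_iff_one M).2 (Ring.jacobson_le_of_isMaximal M h1))
  · intro hx
    rw [maxIdeal, Ring.jacobson_eq_sInf_isMaximal, Submodule.mem_sInf]
    intro M hM
    by_contra hxM
    have hM' : Ideal.IsMaximal M := hM
    have htop : (M : Ideal R) ⊔ Ideal.span {x} = ⊤ := by
      refine hM'.1.2 _ (lt_of_le_of_ne le_sup_left ?_)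
      intro h
      exact hxM (h ▸ (le_sup_right : Ideal.span {x} ≤ M ⊔ Ideal.span {x})
        (Ideal.mem_span_singleton_self x))
    obtain ⟨m, hm, y, hy, hmy⟩ := Submodule.mem_sup.1 ((Ideal.eq_top_iff_one _).1 htop)
    obtain ⟨a, rfl⟩ := Ideal.mem_span_singleton'.1 hy
    rcases IsLocalRing.isUnit_or_isUnit_of_add_one hmy with h | h
    · exact hM'.ne_top (Ideal.eq_top_of_isUnit_mem _ hm h)
    · obtain ⟨c, hc⟩ := h
      have hb : (↑c⁻¹ * a) * x = 1 := by rw [mul_assoc, ← hc, Units.inv_mul]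
      set b : R := ↑c⁻¹ * a
      have hidem : (x * b) * (x * b) = x * b := by
        rw [mul_assoc, ← mul_assoc b, hb, one_mul]
      rcases IsLocalRing.isUnit_or_isUnit_of_add_one (add_sub_cancel (x * b) 1) with h | h
      · have : x * b = 1 := h.mul_left_cancel (by rw [hidem, mul_one])
        exact hx ⟨⟨x, b, this, hb⟩, rfl⟩
      · have h0 : x * b = 0 := h.mul_left_cancel (by rw [sub_mul, hidem]; simp)
        have : x = 0 := by
          calc x = x * (b * x) := by rw [hb, mul_one]
            _ = (x * b) * x := (mul_assoc _ _ _).symm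
            _ = 0 := by rw [h0, zero_mul]
        rw [this, mul_zero] at hb
        exact zero_ne_one hb

theorem isMaximal_iff [IsLocalRing R] {I : Ideal R} : I.IsMaximal ↔ I = maxIdeal R := by
  have key : ∀ J : Ideal R, J.IsMaximal → J = maxIdeal R := fun J hJ =>
    le_antisymm (fun x hx => mem_maxIdeal_iff.2 fun hu =>
      hJ.ne_top (Ideal.eq_top_of_isUnit_mem _ hx hu)) (Ring.jacobson_le_of_isMaximal J)
  refine ⟨key I, ?_⟩
  rintro rfl
  obtain ⟨M, hM⟩ := Ideal.exists_maximal R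
  exact key M hM ▸ hM

variable (R)

/-- The residue ring `d = R/𝔪`. -/
def ResidueSkewField : Type u := R ⧸ maxIdeal R

instance : Ring (ResidueSkewField R) := inferInstanceAs (Ring (R ⧸ maxIdeal R))

/-- The residue class map `R → d`, `r ↦ [r]`. -/
def residue : R →+* ResidueSkewField R := Ideal.Quotient.mk (maxIdeal R)

variable {R}

theorem residue_surjective : Function.Surjective (residue R) := Ideal.Quotient.mk_surjective

theorem residue_eq_zero_iff {r : R} : residue R r = 0 ↔ r ∈ maxIdeal R :=
  Ideal.Quotient.eq_zero_iff_mem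

theorem residue_eq_iff {r s : R} : residue R r = residue R s ↔ r - s ∈ maxIdeal R :=
  Ideal.Quotient.eq

instance [IsLocalRing R] : Nontrivial (ResidueSkewField R) :=
  ⟨⟨residue R 1, 0, fun h => mem_maxIdeal_iff.1 (residue_eq_zero_iff.1 h) isUnit_one⟩⟩

/-- `d = R/𝔪` is a skew field. -/
noncomputable instance [IsLocalRing R] : DivisionRing (ResidueSkewField R) :=
  DivisionRing.ofIsUnitOrEqZero fun a => by
    obtain ⟨r, rfl⟩ := residue_surjective a
    by_cases hr : IsUnit r
    · exact Or.inl (hr.map (residue R))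
    · exact Or.inr (residue_eq_zero_iff.2 (mem_maxIdeal_iff.2 hr))

variable (R)

/-- The conditions `𝔪² = 0` and `𝔪 = Rx = xR` for every `x ∈ 𝔪 \ {0}`. -/
structure SquareZeroPrincipal : Prop where
  mul_eq_zero : ∀ x ∈ maxIdeal R, ∀ y ∈ maxIdeal R, x * y = 0
  eq_left : ∀ x ∈ maxIdeal R, x ≠ 0 → (maxIdeal R : Set R) = {y | ∃ a, y = a * x}
  eq_right : ∀ x ∈ maxIdeal R, x ≠ 0 → (maxIdeal R : Set R) = {y | ∃ a, y = x * a}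

variable {R}

namespace SquareZeroPrincipal

theorem mul_left_eq_zero_iff [IsLocalRing R] (hR : SquareZeroPrincipal R) {x : R} (hx : x ∈ maxIdeal R)
    (hx0 : x ≠ 0) {s : R} : s * x = 0 ↔ s ∈ maxIdeal R :=
  ⟨fun h => mem_maxIdeal_iff.2 fun hu => hx0 ((hu.mul_right_eq_zero).1 h),
    fun h => hR.mul_eq_zero s h x hx⟩

theorem mul_right_eq_zero_iff [IsLocalRing R] (hR : SquareZeroPrincipal R) {x : R} (hx : x ∈ maxIdeal R)
    (hx0 : x ≠ 0) {s : R} : x * s = 0 ↔ s ∈ maxIdeal R :=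
  ⟨fun h => mem_maxIdeal_iff.2 fun hu => hx0 ((hu.mul_left_eq_zero).1 h),
    fun h => hR.mul_eq_zero x hx s h⟩

theorem exists_left (hR : SquareZeroPrincipal R) {x : R} (hx : x ∈ maxIdeal R)
    (hx0 : x ≠ 0) (t : R) : ∃ s, x * t = s * x := by
  have h : x * t ∈ (maxIdeal R : Set R) := (maxIdeal R).mul_mem_right t hx
  rwa [hR.eq_left x hx hx0] at h

theorem exists_right (hR : SquareZeroPrincipal R) {x : R} (hx : x ∈ maxIdeal R)
    (hx0 : x ≠ 0) (s : R) : ∃ t, s * x = x * t := by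
  have h : s * x ∈ (maxIdeal R : Set R) := (maxIdeal R).mul_mem_left s hx
  rwa [hR.eq_right x hx hx0] at h

theorem residue_eq_of_mul [IsLocalRing R] (hR : SquareZeroPrincipal R) {x : R} (hx : x ∈ maxIdeal R)
    (hx0 : x ≠ 0) {s s' : R} (h : s * x = s' * x) : residue R s = residue R s' :=
  residue_eq_iff.2 ((hR.mul_left_eq_zero_iff hx hx0).1 (by rw [sub_mul, h, sub_self]))

/-- The ring homomorphism `R → d` sending `t` to `[s]`, where `x t = s x`. -/
noncomputable def sigmaAux [IsLocalRing R] (hR : SquareZeroPrincipal R) {x : R} (hx : x ∈ maxIdeal R)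
    (hx0 : x ≠ 0) : R →+* ResidueSkewField R :=
  have hs : ∀ t, x * t = (hR.exists_left hx hx0 t).choose * x := fun t =>
    (hR.exists_left hx hx0 t).choose_spec
  { toFun := fun t => residue R (hR.exists_left hx hx0 t).choose
    map_one' := by
      rw [← map_one (residue R)]
      exact hR.residue_eq_of_mul hx hx0 (by rw [← hs, mul_one, one_mul])
    map_zero' := by
      rw [← map_zero (residue R)]
      exact hR.residue_eq_of_mul hx hx0 (by rw [← hs, mul_zero, zero_mul])
    map_add' := fun a b => by
      rw [← map_add]
      exact hR.residue_eq_of_mul hx hx0 (by rw [← hs, add_mul, ← hs, ← hs, mul_add])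
    map_mul' := fun a b => by
      rw [← map_mul]
      exact hR.residue_eq_of_mul hx hx0
        (by rw [← hs, mul_assoc, ← hs, ← mul_assoc, ← mul_assoc, ← hs]) }

theorem sigmaAux_eq [IsLocalRing R] (hR : SquareZeroPrincipal R) {x : R} (hx : x ∈ maxIdeal R)
    (hx0 : x ≠ 0) {s t : R} (h : x * t = s * x) : hR.sigmaAux hx hx0 t = residue R s :=
  hR.residue_eq_of_mul hx hx0 ((hR.exists_left hx hx0 t).choose_spec.symm.trans h)

/-- The ring endomorphism `[t] ↦ [s]` of `d`, where `x t = s x`. -/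
noncomputable def sigmaHom [IsLocalRing R] (hR : SquareZeroPrincipal R) {x : R}
    (hx : x ∈ maxIdeal R) (hx0 : x ≠ 0) : ResidueSkewField R →+* ResidueSkewField R :=
  Ideal.Quotient.lift (maxIdeal R) (hR.sigmaAux hx hx0) fun t ht => by
    rw [hR.sigmaAux_eq hx hx0 (s := 0) (by rw [hR.mul_eq_zero x hx t ht, zero_mul]), map_zero]

theorem sigmaHom_residue [IsLocalRing R] (hR : SquareZeroPrincipal R) {x : R}
    (hx : x ∈ maxIdeal R) (hx0 : x ≠ 0) {s t : R} (h : x * t = s * x) :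
    hR.sigmaHom hx hx0 (residue R t) = residue R s :=
  hR.sigmaAux_eq hx hx0 h

theorem sigmaHom_bijective [IsLocalRing R] (hR : SquareZeroPrincipal R) {x : R}
    (hx : x ∈ maxIdeal R) (hx0 : x ≠ 0) : Function.Bijective (hR.sigmaHom hx hx0) := by
  refine ⟨(hR.sigmaHom hx hx0).injective, fun a => ?_⟩
  obtain ⟨s, rfl⟩ := residue_surjective a
  obtain ⟨t, ht⟩ := hR.exists_right hx hx0 s
  exact ⟨residue R t, hR.sigmaHom_residue hx hx0 ht.symm⟩

/-- The automorphism `σ_x` of the residue skew field attached to `x ∈ 𝔪 \ {0}`, determined by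
`x t = s x → σ_x [t] = [s]` for `s t : R`; see `sigma_residue`. -/
noncomputable def sigma [IsLocalRing R] (hR : SquareZeroPrincipal R) {x : R}
    (hx : x ∈ maxIdeal R) (hx0 : x ≠ 0) : ResidueSkewField R ≃+* ResidueSkewField R :=
  RingEquiv.ofBijective (hR.sigmaHom hx hx0) (hR.sigmaHom_bijective hx hx0)

theorem sigma_residue [IsLocalRing R] (hR : SquareZeroPrincipal R) {x : R} (hx : x ∈ maxIdeal R)
    (hx0 : x ≠ 0) {s t : R} (h : x * t = s * x) :
    hR.sigma hx hx0 (residue R t) = residue R s :=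
  hR.sigmaHom_residue hx hx0 h

end SquareZeroPrincipal

end LocalRing

/-! ### Triangles with translation functor the identity -/

section Triangles

variable (R : Type u) [Ring R]

/-- A diagram `X --u--> Y --v--> Z --w--> X` of left `R`-modules. -/
structure Diagram where
  X : ModuleCat.{u} R
  Y : ModuleCat.{u} R
  Z : ModuleCat.{u} R
  u : X →ₗ[R] Y
  v : Y →ₗ[R] Z
  w : Z →ₗ[R] X

/-- The two categories under consideration: all projective left `R`-modules, or the finitely
generated ones (both full subcategories of the category of left `R`-modules). -/
inductive ProjCat
  | projective
  | finProjective

variable {R}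

/-- The objects of the category. -/
def ProjCat.IsObj : ProjCat → ModuleCat.{u} R → Prop
  | .projective, M => Module.Projective R M
  | .finProjective, M => Module.Projective R M ∧ Module.Finite R M

/-- The index sets over which direct sums are formed: arbitrary ones for all projective modules,
finite ones for finitely generated projective modules. -/
def ProjCat.IsIndex : ProjCat → Type u → Prop
  | .projective, _ => True
  | .finProjective, ι => Finite ι

namespace Diagram

/-- A triangle in the category `C`, with respect to `Σ = Id`: the objects lie in `C` and the
composites `v u`, `w v` and `u w` vanish. -/
structure IsTriangle (C : ProjCat) (t : Diagram R) : Prop where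
  objX : C.IsObj t.X
  objY : C.IsObj t.Y
  objZ : C.IsObj t.Z
  vu : t.v ∘ₗ t.u = 0
  wv : t.w ∘ₗ t.v = 0
  uw : t.u ∘ₗ t.w = 0

/-- Morphisms of triangles. -/
structure Hom (t t' : Diagram R) where
  f : t.X →ₗ[R] t'.X
  g : t.Y →ₗ[R] t'.Y
  h : t.Z →ₗ[R] t'.Z
  comm_u : g ∘ₗ t.u = t'.u ∘ₗ f
  comm_v : h ∘ₗ t.v = t'.v ∘ₗ g
  comm_w : f ∘ₗ t.w = t'.w ∘ₗ h

/-- Isomorphy of triangles. -/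
def IsIso (t t' : Diagram R) : Prop :=
  ∃ φ : Hom t t', Function.Bijective φ.f ∧ Function.Bijective φ.g ∧ Function.Bijective φ.h

/-- The translate `Y --v--> Z --w--> X --(-u)--> Y`. -/
def translate (t : Diagram R) : Diagram R := ⟨t.Y, t.Z, t.X, t.v, t.w, -t.u⟩

/-- The mapping cone
`Y ⊕ X' → Z ⊕ Y' → X ⊕ Z' → Y ⊕ X'` with matrices `(-v 0; g u')`, `(-w 0; h v')`,
`(-u 0; f w')`. -/
def Hom.cone {t t' : Diagram R} (φ : Hom t t') : Diagram R where
  X := ModuleCat.of R (t.Y × t'.X)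
  Y := ModuleCat.of R (t.Z × t'.Y)
  Z := ModuleCat.of R (t.X × t'.Z)
  u := LinearMap.prod (-(t.v ∘ₗ LinearMap.fst R t.Y t'.X))
    (φ.g ∘ₗ LinearMap.fst R t.Y t'.X + t'.u ∘ₗ LinearMap.snd R t.Y t'.X)
  v := LinearMap.prod (-(t.w ∘ₗ LinearMap.fst R t.Z t'.Y))
    (φ.h ∘ₗ LinearMap.fst R t.Z t'.Y + t'.v ∘ₗ LinearMap.snd R t.Z t'.Y)
  w := LinearMap.prod (-(t.u ∘ₗ LinearMap.fst R t.X t'.Z))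
    (φ.f ∘ₗ LinearMap.fst R t.X t'.Z + t'.w ∘ₗ LinearMap.snd R t.X t'.Z)

/-- The triangle `X --id--> X --> 0 --> X`. -/
def identity (X : ModuleCat.{u} R) : Diagram R :=
  ⟨X, X, ModuleCat.of R PUnit.{u + 1}, LinearMap.id, 0, 0⟩

/-- A triangle is contractible if its identity is homotopic to zero. -/
def Contractible (t : Diagram R) : Prop :=
  ∃ (Θ : t.Y →ₗ[R] t.X) (Φ : t.Z →ₗ[R] t.Y) (Ψ : t.X →ₗ[R] t.Z),
    LinearMap.id = Φ ∘ₗ t.v + t.u ∘ₗ Θ ∧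
    LinearMap.id = Ψ ∘ₗ t.w + t.v ∘ₗ Φ ∧
    LinearMap.id = Θ ∘ₗ t.u + t.w ∘ₗ Ψ

/-- The direct sum of a family of triangles. -/
noncomputable def directSum {ι : Type u} (s : ι → Diagram R) : Diagram R where
  X := ModuleCat.of R (DirectSum ι fun i => (s i).X)
  Y := ModuleCat.of R (DirectSum ι fun i => (s i).Y)
  Z := ModuleCat.of R (DirectSum ι fun i => (s i).Z)
  u := DirectSum.lmap fun i => (s i).u
  v := DirectSum.lmap fun i => (s i).v
  w := DirectSum.lmap fun i => (s i).w

/-- The generating triangle `R --(·x)--> R --(·x)--> R --(·ax)--> R` (right multiplications). -/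
def generating (x a : R) : Diagram R where
  X := ModuleCat.of R R
  Y := ModuleCat.of R R
  Z := ModuleCat.of R R
  u := LinearMap.toSpanSingleton R R x
  v := LinearMap.toSpanSingleton R R x
  w := LinearMap.toSpanSingleton R R (a * x)

/-- The triangles of `C` isomorphic to a direct sum (finite for finitely generated modules)
of contractible triangles and of copies of the generating triangle given by `x` and `a`. -/
def Generated (C : ProjCat) (x a : R) : Set (Diagram R) :=
  {t | t.IsTriangle C ∧ ∃ (ι : Type u) (s : ι → Diagram R), C.IsIndex ι ∧
    (∀ i, (s i).IsTriangle C ∧ ((s i).Contractible ∨ s i = generating x a)) ∧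
    IsIso t (directSum s)}

end Diagram

variable (R)

/-- A triangulation of the category `C`, with translation functor `Σ = Id`:
a class of distinguished triangles satisfying the axioms, the last one being the mapping cone
form of the morphism axiom, which includes the octahedral axiom. -/
@[ext]
structure Triangulation (C : ProjCat) where
  /-- the distinguished triangles -/
  dist : Set (Diagram R)
  isTriangle : ∀ t ∈ dist, t.IsTriangle C
  iso_closed : ∀ t ∈ dist, ∀ t' : Diagram R, t'.IsTriangle C → t.IsIso t' → t' ∈ dist
  identity_mem : ∀ X : ModuleCat.{u} R, C.IsObj X → Diagram.identity X ∈ dist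
  exists_triangle : ∀ X Y : ModuleCat.{u} R, C.IsObj X → C.IsObj Y → ∀ u : X →ₗ[R] Y,
    ∃ (Z : ModuleCat.{u} R) (v : Y →ₗ[R] Z) (w : Z →ₗ[R] X), (⟨X, Y, Z, u, v, w⟩ : Diagram R) ∈ dist
  translate_mem_iff : ∀ t : Diagram R, t.IsTriangle C → (t ∈ dist ↔ t.translate ∈ dist)
  exists_cone : ∀ t ∈ dist, ∀ t' ∈ dist, ∀ (f : t.X →ₗ[R] t'.X) (g : t.Y →ₗ[R] t'.Y),
    g ∘ₗ t.u = t'.u ∘ₗ f →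
      ∃ φ : Diagram.Hom t t', φ.f = f ∧ φ.g = g ∧ φ.cone ∈ dist

variable {R}

/-- `T` is the triangulation `Δ^r` given by the generator `x` and the nonzero `r ∈ d`: the
distinguished triangles are those generated by
`R --(·x)--> R --(·x)--> R --(·ax)--> R`, where `a ∈ R` is any lift of `r`. -/
def Triangulation.IsInducedBy {C : ProjCat} (T : Triangulation R C) (x : R)
    (r : ResidueSkewField R) : Prop :=
  r ≠ 0 ∧ ∀ a : R, residue R a = r → T.dist = Diagram.Generated C x a

end Triangles

end ProjTri

open ProjTri

/-!
Write `d` for the residue skew field, and `X_a` for the triangle `R → R → R → R` whose maps are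
right multiplication by `x`, `x` and `a x`.

*Every triangulation is generated.* Completing squares against the triangle `R → 0 → R` shows that
distinguished triangles are exact (`Triangulation.exact`), so by the five lemma a distinguished
triangle is determined by its first map. Exactness forces the triangle on `x : R → R` to be some
`X_a` with `a` a unit (`Triangulation.exists_generating_mem`). Projective modules over `R` are
free, and in suitable bases a map between them is a direct sum of copies of the identity of `R`, of
multiplication by `x` and of zero maps (`IsUniformizer.exists_normalForm`); hence every map starts a triangle
generated by `X_a`, and the generated triangles are exactly the distinguished ones
(`Triangulation.dist_eq_generated`). Completing squares from `X_a` to itself and to its translate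
gives, for the class `r` of `a`, the relations `r σ_x³(t) = t r` and `σ_x r = -r`, which together
force `2 ∈ 𝔪` (`Triangulation.isAdmissible_of_generating_mem`).

*Every admissible `a` generates a triangulation.* Under the same relations the triangles generated
by `X_a` are the saturated ones: the exact triangles to which squares starting at `X_a` can be
completed (`Diagram.mem_generated_iff`). This description is visibly stable under isomorphism and
translation. The mapping cone axiom is the main point (`Diagram.exists_cone_mem_generated`). Up to
homotopy contractible summands can be dropped, which leaves morphisms between triangles whose maps
vanish modulo `𝔪`. For those, a morphism can be changed by a homotopy, and in its last component,
so that only its reduction modulo `𝔪` matters; being a matrix over `d`, the reduction is a split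
epimorphism followed by a split monomorphism (`Diagram.exists_homotopic_factorization`). The cone
of such a composite is a direct sum of a translate of the kernel, of the cokernel, and of a
contractible triangle, hence saturated (`Diagram.Saturated.cone_comp`).

*The classification.* If `x = 2`, then `σ_x` is the identity and the relations say that `r` is
central. If `2 = 0` and `r₀` satisfies them, then `r₀ z` does if and only if `z` is central and
fixed by `σ_x`.
-/

namespace ProjTri

/-! ### Multiplication by a generator of the maximal ideal on projective modules -/

/-- The element `x` generates the maximal ideal `𝔪` of `R` on both sides, and its annihilator on
either side is `𝔪`. Every nonzero `x ∈ 𝔪` has this property in the rings under consideration; see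
`SquareZeroPrincipal.isUniformizer`. -/
structure IsUniformizer {R : Type u} [Ring R] (x : R) : Prop where
  mem : x ∈ maxIdeal R
  mul_left_eq_zero_iff : ∀ {s : R}, s * x = 0 ↔ s ∈ maxIdeal R
  mul_right_eq_zero_iff : ∀ {s : R}, x * s = 0 ↔ s ∈ maxIdeal R
  exists_eq_mul : ∀ {s : R}, s ∈ maxIdeal R → ∃ t, s = t * x
  exists_eq_mul' : ∀ {s : R}, s ∈ maxIdeal R → ∃ t, s = x * t
  exists_left : ∀ t, ∃ s, x * t = s * x
  exists_right : ∀ s, ∃ t, s * x = x * t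

theorem SquareZeroPrincipal.isUniformizer {R : Type u} [Ring R] [IsLocalRing R]
    (hR : SquareZeroPrincipal R) {x : R} (hx : x ∈ maxIdeal R) (hx0 : x ≠ 0) :
    IsUniformizer x where
  mem := hx
  mul_left_eq_zero_iff := hR.mul_left_eq_zero_iff hx hx0
  mul_right_eq_zero_iff := hR.mul_right_eq_zero_iff hx hx0
  exists_eq_mul {s} hs := by
    have h : s ∈ (maxIdeal R : Set R) := hs
    rwa [hR.eq_left x hx hx0] at h
  exists_eq_mul' {s} hs := by
    have h : s ∈ (maxIdeal R : Set R) := hs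
    rwa [hR.eq_right x hx hx0] at h
  exists_left := hR.exists_left hx hx0
  exists_right := hR.exists_right hx hx0

section Uniformizer

variable {R : Type u} [Ring R] {x : R}

namespace IsUniformizer

theorem mul_mul_eq_zero (hx : IsUniformizer x) (r : R) : x * r * x = 0 :=
  hx.mul_left_eq_zero_iff.2 ((maxIdeal R).mul_mem_right r hx.mem)

theorem mul_self (hx : IsUniformizer x) : x * x = 0 :=
  hx.mul_left_eq_zero_iff.2 hx.mem

variable {M : Type*} [AddCommGroup M] [Module R M]

theorem smul_smul_self (hx : IsUniformizer x) (y : M) : x • x • y = 0 := by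
  rw [smul_smul, hx.mul_self, zero_smul]

theorem smul_smul_smul (hx : IsUniformizer x) (r : R) (y : M) : x • r • x • y = 0 := by
  rw [smul_smul, smul_smul, hx.mul_mul_eq_zero, zero_smul]

/-- Over a projective module `M`, the kernel of multiplication by `x` is `x M`. -/
theorem exists_eq_smul (hx : IsUniformizer x) [hM : Module.Projective R M] {y : M}
    (hy : x • y = 0) : ∃ z, y = x • z := by
  obtain ⟨s, hs⟩ := Module.projective_def'.1 hM
  have hc : ∀ m, ∃ t, s y m = x * t := fun m => hx.exists_eq_mul' <|
    hx.mul_right_eq_zero_iff.1 <| by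
      have := DFunLike.congr_fun (congrArg s hy) m
      simpa using this
  choose t ht using hc
  refine ⟨∑ m ∈ (s y).support, t m • m, ?_⟩
  have h := LinearMap.congr_fun hs y
  rw [LinearMap.comp_apply, Finsupp.linearCombination_apply, Finsupp.sum] at h
  rw [LinearMap.id_apply] at h
  conv_lhs => rw [← h]
  rw [Finset.smul_sum]
  exact Finset.sum_congr rfl fun m _ => by rw [ht, mul_smul, id]

/-- The submodule of elements killed by `x`; it is `𝔪 M` when `M` is projective. -/
def ann (hx : IsUniformizer x) (M : Type*) [AddCommGroup M] [Module R M] : Submodule R M where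
  carrier := {y | x • y = 0}
  zero_mem' := smul_zero x
  add_mem' {a b} ha hb := by
    change x • (a + b) = 0
    rw [smul_add, show x • a = 0 from ha, show x • b = 0 from hb, add_zero]
  smul_mem' r y hy := by
    obtain ⟨s, hs⟩ := hx.exists_left r
    change x • r • y = 0
    rw [smul_smul, hs, mul_smul, show x • y = 0 from hy, smul_zero]

theorem mem_ann (hx : IsUniformizer x) {y : M} : y ∈ hx.ann M ↔ x • y = 0 := Iff.rfl

/-- A linear endomorphism of a projective module that is the identity modulo `x` is bijective. -/
theorem bijective_of_smul_eq (hx : IsUniformizer x) [Module.Projective R M] (e : M →ₗ[R] M)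
    (he : ∀ y, x • e y = x • y) : Function.Bijective e := by
  refine ⟨(injective_iff_map_eq_zero e).2 fun y hy => ?_, fun y => ?_⟩
  · obtain ⟨z, rfl⟩ := hx.exists_eq_smul (y := y) (by rw [← he, hy, smul_zero])
    rw [← he, ← map_smul, hy]
  · obtain ⟨z, hz⟩ := hx.exists_eq_smul (y := e y - y) (by rw [smul_sub, he, sub_self])
    refine ⟨y - x • z, ?_⟩
    rw [map_sub, map_smul, he, ← hz, sub_sub_cancel]

instance : RingHomSurjective (residue R) := ⟨residue_surjective⟩

/-- The reduction `M / 𝔪 M` of a projective module as a vector space over the residue skew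
field, presented by a semilinear surjection whose kernel is the kernel of multiplication by `x`. -/
theorem exists_reduction [IsLocalRing R] (hx : IsUniformizer x) (M : Type u) [AddCommGroup M]
    [Module R M] :
    ∃ (V : Type u) (_ : AddCommGroup V) (_ : Module (ResidueSkewField R) V)
      (q : M →ₛₗ[residue R] V), Function.Surjective q ∧ ∀ y, q y = 0 ↔ x • y = 0 := by
  let V := M ⧸ hx.ann M
  let ρ : ResidueSkewField R →+* AddMonoid.End V :=
    Ideal.Quotient.lift (maxIdeal R) (Module.toAddMonoidEnd R V) fun r hr => by
      ext v
      obtain ⟨y, rfl⟩ := Submodule.Quotient.mk_surjective _ v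
      obtain ⟨t, rfl⟩ := hx.exists_eq_mul' hr
      change (x * t) • (Submodule.Quotient.mk y : V) = 0
      rw [← Submodule.Quotient.mk_smul, Submodule.Quotient.mk_eq_zero, mem_ann, mul_smul,
        hx.smul_smul_self]
  let _ : Module (ResidueSkewField R) V := Module.compHom V ρ
  exact ⟨V, inferInstance, inferInstance,
    { toFun := Submodule.Quotient.mk
      map_add' := fun _ _ => rfl
      map_smul' := fun _ _ => rfl },
    Submodule.Quotient.mk_surjective _, fun y => Submodule.Quotient.mk_eq_zero _⟩

end IsUniformizer

/-- Nakayama's lemma: in a projective module, a family whose reduction is a basis is a basis. -/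
theorem IsUniformizer.isBasis_of_reduction [IsLocalRing R] (hx : IsUniformizer x)
    {M V : Type*} [AddCommGroup M] [Module R M] [Module.Projective R M]
    [AddCommGroup V] [Module (ResidueSkewField R) V] {q : M →ₛₗ[residue R] V}
    (hq : ∀ y, q y = 0 ↔ x • y = 0) {ι : Type*} {b : ι → M}
    (hli : LinearIndependent (ResidueSkewField R) (q ∘ b))
    (hsp : ⊤ ≤ Submodule.span (ResidueSkewField R) (Set.range (q ∘ b))) :
    ∃ B : Module.Basis ι R M, ∀ i, B i = b i := by
  have key : ∀ (s : Finset ι) (g : ι → R), x • ∑ i ∈ s, g i • b i = 0 →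
      ∀ i ∈ s, g i ∈ maxIdeal R := by
    intro s g h i hi
    rw [← hq, map_sum] at h
    simp only [map_smulₛₗ] at h
    exact residue_eq_zero_iff.1 (linearIndependent_iff'.1 hli s (fun i => residue R (g i)) h i hi)
  have hli' : LinearIndependent R b := by
    refine linearIndependent_iff'.2 fun s g h i hi => ?_
    have h1 := key s g (by rw [h, smul_zero])
    have h2 : ∀ i, ∃ t, i ∈ s → g i = x * t := fun i => by
      by_cases hi : i ∈ s
      · obtain ⟨t, ht⟩ := hx.exists_eq_mul' (h1 i hi)
        exact ⟨t, fun _ => ht⟩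
      · exact ⟨0, fun h => absurd h hi⟩
    choose t ht using h2
    have h3 := key s t (by
      rw [Finset.smul_sum, ← h]
      exact Finset.sum_congr rfl fun i hi => by rw [ht i hi, mul_smul]) i hi
    rw [ht i hi, hx.mul_right_eq_zero_iff.2 h3]
  have hmod : ∀ y : M, ∃ z ∈ Submodule.span R (Set.range b), ∃ k, y = z + x • k := by
    intro y
    have hy : q y ∈ Submodule.map q (Submodule.span R (Set.range b)) := by
      rw [Submodule.map_span, ← Set.range_comp]
      exact hsp trivial
    obtain ⟨z, hz, hzy⟩ := hy
    obtain ⟨k, hk⟩ := hx.exists_eq_smul (y := y - z)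
      ((hq _).1 (by rw [map_sub, hzy, sub_self]))
    exact ⟨z, hz, k, by rw [← hk, add_sub_cancel]⟩
  have hsp' : ⊤ ≤ Submodule.span R (Set.range b) := by
    intro y _
    obtain ⟨z, hz, k, rfl⟩ := hmod y
    obtain ⟨z', hz', k', rfl⟩ := hmod k
    rw [smul_add, hx.smul_smul_self, add_zero]
    exact add_mem hz (Submodule.smul_mem _ _ hz')
  exact ⟨Module.Basis.mk hli' hsp', fun i => by rw [Module.Basis.mk_apply]⟩

end Uniformizer

/-! ### Normal form of a map between projective modules -/

section NormalForm

variable {R : Type u} [Ring R] [IsLocalRing R] {x : R}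

/-- A family in a projective module that is independent modulo `𝔪` extends to a basis. -/
theorem IsUniformizer.exists_basis_extending (hx : IsUniformizer x)
    {M V : Type u} [AddCommGroup M] [Module R M] [Module.Projective R M]
    [AddCommGroup V] [Module (ResidueSkewField R) V] {q : M →ₛₗ[residue R] V}
    (hqs : Function.Surjective q) (hq : ∀ y, q y = 0 ↔ x • y = 0) {ι : Type u} {b : ι → M}
    (hli : LinearIndependent (ResidueSkewField R) (q ∘ b)) :
    ∃ (L : Type u) (B : Module.Basis (ι ⊕ L) R M), ∀ i, B (Sum.inl i) = b i := by
  let B₀ := Module.Basis.sumExtend hli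
  let L : Type u := Module.Basis.sumExtendIndex hli
  let c : ι ⊕ L → M := Sum.elim b fun l => Function.surjInv hqs (B₀ (Sum.inr l))
  have hc : q ∘ c = B₀ := by
    funext i
    rcases i with i | l
    · change q (b i) = B₀ (Sum.inl i)
      simp only [B₀, Module.Basis.sumExtend, Module.Basis.reindex_apply,
        Module.Basis.extend_apply_self]
      rfl
    · exact Function.surjInv_eq hqs _
  obtain ⟨B, hB⟩ := hx.isBasis_of_reduction hq (b := c) (hc ▸ B₀.linearIndependent)
    (by rw [hc, B₀.span_eq])
  exact ⟨L, B, fun i => hB _⟩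

/-- Every map of projective modules is, in suitable bases, a direct sum of copies of the identity
of `R`, of multiplication by `x` on `R`, and of zero maps to or from `R`. -/
theorem IsUniformizer.exists_normalForm (hx : IsUniformizer x) {X Y : Type u}
    [AddCommGroup X] [Module R X] [Module.Projective R X]
    [AddCommGroup Y] [Module R Y] [Module.Projective R Y] (u : X →ₗ[R] Y) :
    ∃ (I J K L : Type u) (bX : Module.Basis (I ⊕ J ⊕ K) R X) (bY : Module.Basis (I ⊕ J ⊕ L) R Y),
      (∀ i, u (bX (Sum.inl i)) = bY (Sum.inl i)) ∧
      (∀ j, u (bX (Sum.inr (Sum.inl j))) = x • bY (Sum.inr (Sum.inl j))) ∧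
      ∀ k, u (bX (Sum.inr (Sum.inr k))) = 0 := by
  obtain ⟨V, _, _, q, hqs, hq⟩ := hx.exists_reduction X
  obtain ⟨V', _, _, q', hqs', hq'⟩ := hx.exists_reduction Y
  -- The reduction of `X` is filtered by `A₀`, the image of the kernel of `u`, and `A₁`, the image
  -- of the preimage of `𝔪 Y`; an adapted basis of it is lifted to `X`.
  let A₀ : Submodule (ResidueSkewField R) V := Submodule.map q (LinearMap.ker u)
  let A₁ : Submodule (ResidueSkewField R) V := Submodule.map q ((hx.ann Y).comap u)
  have hA : A₀ ≤ A₁ := Submodule.map_mono fun y hy => by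
    rw [Submodule.mem_comap, hx.mem_ann, LinearMap.mem_ker.1 hy, smul_zero]
  obtain ⟨b₀, hb₀, -, hs₀, hl₀⟩ := exists_linearIndepOn_id_extension
    (linearIndepOn_empty (ResidueSkewField R) (id : V → V)) (Set.empty_subset (A₀ : Set V))
  obtain ⟨b₁, hb₁, h01, hs₁, hl₁⟩ := exists_linearIndepOn_id_extension hl₀
    (hb₀.trans hA : b₀ ⊆ (A₁ : Set V))
  obtain ⟨b₂, -, h12, hs₂, hl₂⟩ := exists_linearIndepOn_id_extension hl₁ (Set.subset_univ _)
  have hspan₀ : Submodule.span (ResidueSkewField R) (id '' b₀) = A₀ := by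
    rw [Set.image_id]; exact le_antisymm (Submodule.span_le.2 hb₀) hs₀
  have hspan₁ : Submodule.span (ResidueSkewField R) (id '' b₁) = A₁ := by
    rw [Set.image_id]; exact le_antisymm (Submodule.span_le.2 hb₁) hs₁
  have hquot₀ : LinearIndepOn (ResidueSkewField R) (A₀.mkQ ∘ id) (b₁ \ b₀) := by
    rw [← hspan₀]
    refine ((linearIndepOn_union_iff_quotient Set.disjoint_sdiff_right).1 ?_).2
    rwa [Set.union_sdiff_cancel h01]
  have hquot₁ : LinearIndepOn (ResidueSkewField R) (A₁.mkQ ∘ id) (b₂ \ b₁) := by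
    rw [← hspan₁]
    refine ((linearIndepOn_union_iff_quotient Set.disjoint_sdiff_right).1 ?_).2
    rwa [Set.union_sdiff_cancel h12]
  have hlift : ∀ v : V, ∃ y, q y = v ∧ (v ∈ b₀ → u y = 0) ∧
      (v ∈ b₁ → ∃ z, u y = x • z) := by
    intro v
    by_cases hv₀ : v ∈ b₀
    · obtain ⟨y, hy, rfl⟩ := hb₀ hv₀
      exact ⟨y, rfl, fun _ => hy, fun _ => ⟨0, by rw [smul_zero, LinearMap.mem_ker.1 hy]⟩⟩
    by_cases hv₁ : v ∈ b₁
    · obtain ⟨y, hy, rfl⟩ := hb₁ hv₁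
      exact ⟨y, rfl, fun h => absurd h hv₀, fun _ => hx.exists_eq_smul hy⟩
    · obtain ⟨y, rfl⟩ := hqs v
      exact ⟨y, rfl, fun h => absurd h hv₀, fun h => absurd h hv₁⟩
  choose ℓ hℓ hℓ₀ hℓ₁ using hlift
  have hz : ∀ v : ↥(b₁ \ b₀), ∃ z, u (ℓ v) = x • z := fun v => hℓ₁ v v.2.1
  choose z hz using hz
  have hcomp : q ∘ (fun v : b₂ => ℓ v) = ((↑) : b₂ → V) := funext fun v => hℓ v
  obtain ⟨B, hB⟩ := hx.isBasis_of_reduction hq (b := fun v : b₂ => ℓ v)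
    (by rw [hcomp]; exact hl₂) (by rw [hcomp, Subtype.range_coe]; exact fun v _ => hs₂ trivial)
  -- In a relation modulo `𝔪` among the images `u (ℓ v)` and the `z v`, multiplication by `x` turns
  -- the `z v` into values of `u`; this kills first the coefficients over `b₁`, then the others.
  let F : ↥(b₂ \ b₁) ⊕ ↥(b₁ \ b₀) → Y := Sum.elim (fun v => u (ℓ v)) z
  have hF : LinearIndependent (ResidueSkewField R) (q' ∘ F) := by
    rw [linearIndependent_iff']
    intro s g h
    choose c hc using fun i => residue_surjective (R := R) (g i)
    choose τ hτ using fun i => hx.exists_left (c i)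
    rw [Finset.sum_sum_eq_sum_toLeft_add_sum_toRight] at h
    have h1 : x • (u (∑ i ∈ s.toLeft, c (Sum.inl i) • ℓ i) +
        ∑ j ∈ s.toRight, c (Sum.inr j) • z j) = 0 := by
      rw [← hq', map_add, map_sum, map_sum, map_sum, ← h]
      simp only [map_smul, map_smulₛₗ, hc]
      rfl
    have h2 : x • ∑ j ∈ s.toRight, c (Sum.inr j) • z j =
        u (∑ j ∈ s.toRight, τ (Sum.inr j) • ℓ j) := by
      rw [map_sum, Finset.smul_sum]
      exact Finset.sum_congr rfl fun j _ => by
        rw [map_smul, hz, smul_smul, smul_smul, hτ]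
    have h3 : ∀ j ∈ s.toRight, g (Sum.inr j) = 0 := by
      have h4 : ∑ j ∈ s.toRight, residue R (τ (Sum.inr j)) • (j : V) ∈ A₀ := by
        refine ⟨x • (∑ i ∈ s.toLeft, c (Sum.inl i) • ℓ i) +
          ∑ j ∈ s.toRight, τ (Sum.inr j) • ℓ j, ?_, ?_⟩
        · rw [SetLike.mem_coe, LinearMap.mem_ker, map_add, ← h2, map_smul, ← smul_add, h1]
        · rw [map_add, (hq _).2 (hx.smul_smul_self _), zero_add, map_sum]
          exact Finset.sum_congr rfl fun j _ => by rw [map_smulₛₗ, hℓ]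
      intro j hj
      have h5 := linearIndependent_iff'.1 hquot₀ s.toRight
        (fun j => residue R (τ (Sum.inr j))) (by
          have := (Submodule.Quotient.mk_eq_zero A₀).2 h4
          rw [← Submodule.mkQ_apply, map_sum] at this
          simpa using this) j hj
      rw [← hc, residue_eq_zero_iff, ← hx.mul_right_eq_zero_iff, hτ, hx.mul_left_eq_zero_iff]
      exact residue_eq_zero_iff.1 h5
    have h6 : ∀ i ∈ s.toLeft, g (Sum.inl i) = 0 := by
      have h4 : ∑ i ∈ s.toLeft, g (Sum.inl i) • (i : V) ∈ A₁ := by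
        refine ⟨∑ i ∈ s.toLeft, c (Sum.inl i) • ℓ i, ?_, ?_⟩
        · rw [SetLike.mem_coe, Submodule.mem_comap, hx.mem_ann]
          rw [smul_add, Finset.smul_sum] at h1
          rw [← h1, left_eq_add]
          refine Finset.sum_eq_zero fun j hj => ?_
          rw [smul_smul, hx.mul_right_eq_zero_iff.2, zero_smul]
          rw [← residue_eq_zero_iff, hc, h3 j hj]
        · rw [map_sum]
          exact Finset.sum_congr rfl fun j _ => by rw [map_smulₛₗ, hℓ, hc]
      exact linearIndependent_iff'.1 hquot₁ s.toLeft (fun i => g (Sum.inl i)) (by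
          have := (Submodule.Quotient.mk_eq_zero A₁).2 h4
          rw [← Submodule.mkQ_apply, map_sum] at this
          simpa using this)
    rintro (i | j) hi
    · exact h6 i (Finset.mem_toLeft.2 hi)
    · exact h3 j (Finset.mem_toRight.2 hi)
  obtain ⟨L, BY, hBY⟩ := hx.exists_basis_extending hqs' hq' hF
  classical
  let e : ↥(b₂ \ b₁) ⊕ ↥(b₁ \ b₀) ⊕ ↥b₀ ≃ ↥b₂ :=
    (Equiv.sumCongr (Equiv.refl _) ((Equiv.sumComm _ _).trans (Equiv.Set.sumDiffSubset h01))).trans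
      ((Equiv.sumComm _ _).trans (Equiv.Set.sumDiffSubset h12))
  refine ⟨↥(b₂ \ b₁), ↥(b₁ \ b₀), ↥b₀, L, B.reindex e.symm,
    BY.reindex (Equiv.sumAssoc _ _ _), fun i => ?_, fun j => ?_, fun k => ?_⟩
  · rw [Module.Basis.reindex_apply, Module.Basis.reindex_apply, hB]
    exact (hBY (Sum.inl i)).symm
  · rw [Module.Basis.reindex_apply, Module.Basis.reindex_apply, hB]
    refine (hz j).trans (congrArg (x • ·) (hBY (Sum.inr j)).symm)
  · rw [Module.Basis.reindex_apply, hB]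
    exact hℓ₀ _ k.2

end NormalForm

/-! ### Preliminaries on projective modules and direct sums -/

section Diagrams

variable {R : Type u} [Ring R]

theorem ProjCat.IsObj.projective {C : ProjCat} {M : ModuleCat.{u} R} (h : C.IsObj M) :
    Module.Projective R M := by
  cases C
  · exact h
  · exact h.1

theorem ProjCat.isObj_self (C : ProjCat) : C.IsObj (ModuleCat.of R R) := by
  cases C
  · exact inferInstanceAs (Module.Projective R R)
  · exact ⟨inferInstanceAs (Module.Projective R R), inferInstanceAs (Module.Finite R R)⟩

theorem ProjCat.isObj_punit (C : ProjCat) : C.IsObj (ModuleCat.of R PUnit.{u + 1}) := by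
  have : Module.Projective R PUnit.{u + 1} :=
    Module.Projective.of_lifting_property'' fun _ _ => ⟨0, by ext⟩
  cases C
  · exact this
  · exact ⟨this, inferInstanceAs (Module.Finite R PUnit.{u + 1})⟩

theorem ProjCat.isObj_directSum {C : ProjCat} {ι : Type u} (hι : C.IsIndex ι)
    {M : ι → ModuleCat.{u} R} (hM : ∀ i, C.IsObj (M i)) :
    C.IsObj (ModuleCat.of R (DirectSum ι fun i => M i)) := by
  have h1 : ∀ i, Module.Projective R (M i) := fun i => (hM i).projective
  have h2 : Module.Projective R (DirectSum ι fun i => M i) :=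
    inferInstanceAs (Module.Projective R (Π₀ i, M i))
  cases C
  · exact h2
  · have h3 : ∀ i, Module.Finite R (M i) := fun i => (hM i).2
    have : Finite ι := hι
    have := Fintype.ofFinite ι
    classical
    exact ⟨h2, Module.Finite.equiv (DirectSum.linearEquivFunOnFintype R ι fun i => M i).symm⟩

theorem ProjCat.isObj_prod {C : ProjCat} {M N : ModuleCat.{u} R} (hM : C.IsObj M)
    (hN : C.IsObj N) : C.IsObj (ModuleCat.of R (M × N)) := by
  have := hM.projective
  have := hN.projective
  have h : Module.Projective R (M × N) := inferInstance
  cases C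
  · exact h
  · have := hM.2
    have := hN.2
    exact ⟨h, inferInstanceAs (Module.Finite R (M × N))⟩

theorem exists_comp_eq_of_forall_mem_range {P M N : Type*} [AddCommGroup P] [Module R P]
    [Module.Projective R P] [AddCommGroup M] [Module R M] [AddCommGroup N] [Module R N]
    (b : M →ₗ[R] N) (a : P →ₗ[R] N) (h : ∀ p, ∃ m, b m = a p) : ∃ c : P →ₗ[R] M, b ∘ₗ c = a := by
  obtain ⟨c, hc⟩ := Module.projective_lifting_property b.rangeRestrict
    (a.codRestrict (LinearMap.range b) h) b.surjective_rangeRestrict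
  refine ⟨c, LinearMap.ext fun p => ?_⟩
  exact congrArg Subtype.val (LinearMap.congr_fun hc p)

theorem exists_directSum_of_forall {ι : Type*} {M : ι → Type*} [∀ i, AddCommGroup (M i)]
    (P : ∀ i, M i → Prop) (s : Set ι) (hs : s.Finite) (h0 : ∀ i ∉ s, P i 0)
    (h : ∀ i, ∃ y, P i y) : ∃ y : DirectSum ι M, ∀ i, P i (y i) := by
  classical
  choose y hy using h
  refine ⟨DirectSum.mk M hs.toFinset fun i => y i, fun i => ?_⟩
  by_cases hi : i ∈ hs.toFinset
  · rw [DirectSum.mk_apply_of_mem hi]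
    exact hy i
  · rw [DirectSum.mk_apply_of_notMem hi]
    exact h0 i fun h => hi (hs.mem_toFinset.2 h)

theorem finite_setOf_apply_ne_zero {ι : Type*} {M : ι → Type*} [∀ i, AddCommGroup (M i)]
    (y : DirectSum ι M) : {i | y i ≠ 0}.Finite := by
  classical
  exact (DFinsupp.support y).finite_toSet.subset fun i hi => by simpa using hi

theorem exact_lmap {ι : Type*} {M N P : ι → Type*} [∀ i, AddCommGroup (M i)]
    [∀ i, Module R (M i)] [∀ i, AddCommGroup (N i)] [∀ i, Module R (N i)]
    [∀ i, AddCommGroup (P i)] [∀ i, Module R (P i)] {a : ∀ i, M i →ₗ[R] N i}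
    {b : ∀ i, N i →ₗ[R] P i} (h : ∀ i, Function.Exact (a i) (b i)) :
    Function.Exact (DirectSum.lmap a) (DirectSum.lmap b) := by
  intro y
  constructor
  · intro hy
    obtain ⟨z, hz⟩ := exists_directSum_of_forall (fun i m => a i m = y i) _
      (finite_setOf_apply_ne_zero y) (fun i hi => by
        rw [map_zero]; exact (not_not.1 hi).symm)
      fun i => (h i (y i)).1 (by rw [← DirectSum.lmap_apply, hy]; rfl)
    exact ⟨z, DirectSum.ext fun i => hz i⟩
  · rintro ⟨z, rfl⟩
    exact DirectSum.ext fun i => (h i).apply_apply_eq_zero _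

namespace Diagram

/-! ### Morphisms of triangles -/

theorem Hom.u_apply {t t' : Diagram R} (φ : Hom t t') (p : t.X) : φ.g (t.u p) = t'.u (φ.f p) :=
  LinearMap.congr_fun φ.comm_u p

theorem Hom.v_apply {t t' : Diagram R} (φ : Hom t t') (y : t.Y) : φ.h (t.v y) = t'.v (φ.g y) :=
  LinearMap.congr_fun φ.comm_v y

theorem Hom.w_apply {t t' : Diagram R} (φ : Hom t t') (z : t.Z) : φ.f (t.w z) = t'.w (φ.h z) :=
  LinearMap.congr_fun φ.comm_w z

/-- The identity morphism of a triangle. -/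
def Hom.id (t : Diagram R) : Hom t t := ⟨LinearMap.id, LinearMap.id, LinearMap.id, rfl, rfl, rfl⟩

/-- Composition of morphisms of triangles, in the order of composition of functions. -/
def Hom.comp {t t' t'' : Diagram R} (ψ : Hom t' t'') (φ : Hom t t') : Hom t t'' where
  f := ψ.f ∘ₗ φ.f
  g := ψ.g ∘ₗ φ.g
  h := ψ.h ∘ₗ φ.h
  comm_u := by ext p; simp [φ.u_apply, ψ.u_apply]
  comm_v := by ext p; simp [φ.v_apply, ψ.v_apply]
  comm_w := by ext p; simp [φ.w_apply, ψ.w_apply]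

theorem Hom.eq_of_components {t t' : Diagram R} {φ ψ : Hom t t'} (hf : φ.f = ψ.f)
    (hg : φ.g = ψ.g) (hh : φ.h = ψ.h) : φ = ψ := by
  cases φ
  cases ψ
  simp only at hf hg hh
  subst hf hg hh
  rfl

theorem exists_hom_inverse {t t' : Diagram R} (φ : Hom t t') (hf : Function.Bijective φ.f)
    (hg : Function.Bijective φ.g) (hh : Function.Bijective φ.h) :
    ∃ ψ : Hom t' t, ψ.comp φ = Hom.id t ∧ φ.comp ψ = Hom.id t' := by
  let F := LinearEquiv.ofBijective φ.f hf
  let G := LinearEquiv.ofBijective φ.g hg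
  let H := LinearEquiv.ofBijective φ.h hh
  have hF : ∀ p, φ.f (F.symm p) = p := F.apply_symm_apply
  have hG : ∀ p, φ.g (G.symm p) = p := G.apply_symm_apply
  have hH : ∀ p, φ.h (H.symm p) = p := H.apply_symm_apply
  refine ⟨⟨F.symm, G.symm, H.symm, ?_, ?_, ?_⟩, ?_, ?_⟩
  · ext p; apply hg.1; simp [hG, φ.u_apply, hF]
  · ext p; apply hh.1; simp [hG, φ.v_apply, hH]
  · ext p; apply hf.1; simp [hH, φ.w_apply, hF]
  · simp only [Hom.comp, Hom.id, Hom.mk.injEq]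
    exact ⟨LinearMap.ext F.symm_apply_apply, LinearMap.ext G.symm_apply_apply,
      LinearMap.ext H.symm_apply_apply⟩
  · simp only [Hom.comp, Hom.id, Hom.mk.injEq]
    exact ⟨LinearMap.ext hF, LinearMap.ext hG, LinearMap.ext hH⟩

theorem IsIso.symm {t t' : Diagram R} (h : IsIso t t') : IsIso t' t := by
  obtain ⟨φ, hf, hg, hh⟩ := h
  obtain ⟨ψ, h1, h2⟩ := exists_hom_inverse φ hf hg hh
  simp only [Hom.comp, Hom.id, Hom.mk.injEq] at h1 h2
  refine ⟨ψ, ?_, ?_, ?_⟩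
  · exact ⟨Function.LeftInverse.injective (LinearMap.congr_fun h2.1),
      Function.RightInverse.surjective (LinearMap.congr_fun h1.1)⟩
  · exact ⟨Function.LeftInverse.injective (LinearMap.congr_fun h2.2.1),
      Function.RightInverse.surjective (LinearMap.congr_fun h1.2.1)⟩
  · exact ⟨Function.LeftInverse.injective (LinearMap.congr_fun h2.2.2),
      Function.RightInverse.surjective (LinearMap.congr_fun h1.2.2)⟩

theorem IsIso.trans {t t' t'' : Diagram R} (h : IsIso t t') (h' : IsIso t' t'') :
    IsIso t t'' := by
  obtain ⟨φ, hf, hg, hh⟩ := h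
  obtain ⟨ψ, hf', hg', hh'⟩ := h'
  exact ⟨ψ.comp φ, hf'.comp hf, hg'.comp hg, hh'.comp hh⟩

/-! ### Exact triangles -/

/-- Exactness of a triangle at each of its three vertices. -/
structure Exact (t : Diagram R) : Prop where
  exact_uv : Function.Exact t.u t.v
  exact_vw : Function.Exact t.v t.w
  exact_wu : Function.Exact t.w t.u

theorem Exact.directSum {ι : Type u} {s : ι → Diagram R} (hs : ∀ i, (s i).Exact) :
    (directSum s).Exact :=
  ⟨exact_lmap fun i => (hs i).exact_uv, exact_lmap fun i => (hs i).exact_vw,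
    exact_lmap fun i => (hs i).exact_wu⟩

theorem exact_of_bijective {A B D A' B' D' : Type*} [AddCommGroup A] [AddCommGroup B]
    [AddCommGroup D] [AddCommGroup A'] [AddCommGroup B'] [AddCommGroup D']
    [Module R A] [Module R B] [Module R D] [Module R A'] [Module R B'] [Module R D']
    {a : A →ₗ[R] B} {b : B →ₗ[R] D} {a' : A' →ₗ[R] B'} {b' : B' →ₗ[R] D'}
    {f : A →ₗ[R] A'} {g : B →ₗ[R] B'} {h : D →ₗ[R] D'} (hf : Function.Surjective f)
    (hg : Function.Injective g) (hh : Function.Injective h) (h1 : ∀ p, g (a p) = a' (f p))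
    (h2 : ∀ p, h (b p) = b' (g p)) (ha : Function.Exact a' b') : Function.Exact a b := by
  intro y
  rw [← (map_eq_zero_iff h hh), h2, ha (g y)]
  constructor
  · rintro ⟨p, hp⟩
    obtain ⟨q, rfl⟩ := hf p
    exact ⟨q, hg (by rw [h1, hp])⟩
  · rintro ⟨p, rfl⟩
    exact ⟨f p, (h1 p).symm⟩

theorem Exact.of_isIso {t t' : Diagram R} (h : IsIso t t') (ht : t'.Exact) : t.Exact := by
  obtain ⟨φ, hf, hg, hh⟩ := h
  exact ⟨exact_of_bijective hf.2 hg.1 hh.1 φ.u_apply φ.v_apply ht.exact_uv,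
    exact_of_bijective hg.2 hh.1 hf.1 φ.v_apply φ.w_apply ht.exact_vw,
    exact_of_bijective hh.2 hf.1 hg.1 φ.w_apply φ.u_apply ht.exact_wu⟩

theorem Exact.bijective_h {t t' : Diagram R} (ht : t.Exact) (ht' : t'.Exact) (φ : Hom t t')
    (hf : Function.Bijective φ.f) (hg : Function.Bijective φ.g) : Function.Bijective φ.h :=
  AddMonoidHom.bijective_of_surjective_of_bijective_of_bijective_of_injective
    t.u.toAddMonoidHom t.v.toAddMonoidHom t.w.toAddMonoidHom t.u.toAddMonoidHom
    t'.u.toAddMonoidHom t'.v.toAddMonoidHom t'.w.toAddMonoidHom t'.u.toAddMonoidHom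
    φ.f.toAddMonoidHom φ.g.toAddMonoidHom φ.h.toAddMonoidHom φ.f.toAddMonoidHom
    φ.g.toAddMonoidHom
    (AddMonoidHom.ext fun p => (φ.u_apply p).symm) (AddMonoidHom.ext fun p => (φ.v_apply p).symm)
    (AddMonoidHom.ext fun p => (φ.w_apply p).symm) (AddMonoidHom.ext fun p => (φ.u_apply p).symm)
    ht.exact_uv ht.exact_vw ht.exact_wu ht'.exact_uv ht'.exact_vw ht'.exact_wu hf.2 hg hf hg.1

theorem IsTriangle.vu_apply {C : ProjCat} {t : Diagram R} (ht : t.IsTriangle C) (p : t.X) :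
    t.v (t.u p) = 0 := LinearMap.congr_fun ht.vu p

theorem IsTriangle.wv_apply {C : ProjCat} {t : Diagram R} (ht : t.IsTriangle C) (p : t.Y) :
    t.w (t.v p) = 0 := LinearMap.congr_fun ht.wv p

theorem IsTriangle.uw_apply {C : ProjCat} {t : Diagram R} (ht : t.IsTriangle C) (p : t.Z) :
    t.u (t.w p) = 0 := LinearMap.congr_fun ht.uw p

theorem IsTriangle.translate {C : ProjCat} {t : Diagram R} (ht : t.IsTriangle C) :
    t.translate.IsTriangle C where
  objX := ht.objY
  objY := ht.objZ
  objZ := ht.objX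
  vu := ht.wv
  wv := by
    change (-t.u) ∘ₗ t.w = 0
    rw [LinearMap.neg_comp, ht.uw, neg_zero]
  uw := by
    change t.v ∘ₗ (-t.u) = 0
    rw [LinearMap.comp_neg, ht.vu, neg_zero]

theorem isTriangle_identity {C : ProjCat} {X : ModuleCat.{u} R} (hX : C.IsObj X) :
    (identity X).IsTriangle C :=
  ⟨hX, hX, C.isObj_punit, rfl, rfl, LinearMap.comp_zero _⟩

theorem IsTriangle.directSum {C : ProjCat} {ι : Type u} (hι : C.IsIndex ι) {s : ι → Diagram R}
    (hs : ∀ i, (s i).IsTriangle C) : (directSum s).IsTriangle C where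
  objX := ProjCat.isObj_directSum hι fun i => (hs i).objX
  objY := ProjCat.isObj_directSum hι fun i => (hs i).objY
  objZ := ProjCat.isObj_directSum hι fun i => (hs i).objZ
  vu := LinearMap.ext fun y : DirectSum ι fun i => (s i).X =>
    DirectSum.ext fun i => (hs i).vu_apply (y i)
  wv := LinearMap.ext fun y : DirectSum ι fun i => (s i).Y =>
    DirectSum.ext fun i => (hs i).wv_apply (y i)
  uw := LinearMap.ext fun y : DirectSum ι fun i => (s i).Z =>
    DirectSum.ext fun i => (hs i).uw_apply (y i)

/-! ### Contractible triangles -/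

theorem Contractible.exact {C : ProjCat} {t : Diagram R} (hc : t.Contractible)
    (ht : t.IsTriangle C) : t.Exact := by
  obtain ⟨Θ, Φ, Ψ, h1, h2, h3⟩ := hc
  refine ⟨fun y => ⟨fun hy => ⟨Θ y, ?_⟩, ?_⟩, fun z => ⟨fun hz => ⟨Φ z, ?_⟩, ?_⟩,
    fun p => ⟨fun hp => ⟨Ψ p, ?_⟩, ?_⟩⟩
  · simpa [hy] using (LinearMap.congr_fun h1 y).symm
  · rintro ⟨p, rfl⟩; exact ht.vu_apply p
  · simpa [hz] using (LinearMap.congr_fun h2 z).symm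
  · rintro ⟨p, rfl⟩; exact ht.wv_apply p
  · simpa [hp] using (LinearMap.congr_fun h3 p).symm
  · rintro ⟨p, rfl⟩; exact ht.uw_apply p

theorem contractible_identity (X : ModuleCat.{u} R) : (identity X).Contractible :=
  ⟨LinearMap.id, 0, 0, (zero_add _).symm, LinearMap.ext fun _ => Subsingleton.elim (α := PUnit) _ _,
    (add_zero _).symm⟩

theorem Contractible.translate {t : Diagram R} (hc : t.Contractible) :
    t.translate.Contractible := by
  obtain ⟨Θ, Φ, Ψ, h1, h2, h3⟩ := hc
  refine ⟨Φ, Ψ, -Θ, ?_, ?_, ?_⟩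
  · exact h2
  · refine h3.trans ?_
    ext p
    change Θ (t.u p) + t.w (Ψ p) = -Θ (-t.u p) + t.w (Ψ p)
    rw [map_neg, neg_neg]
  · refine h1.trans ?_
    ext p
    change Φ (t.v p) + t.u (Θ p) = Φ (t.v p) + -t.u (-Θ p)
    rw [map_neg, neg_neg]

/-! ### Completion of squares to morphisms -/

/-- Every commutative square on the first maps of `t` and `t'` extends to a morphism of triangles
`t → t'`. -/
def Completes (t t' : Diagram R) : Prop :=
  ∀ (f : t.X →ₗ[R] t'.X) (g : t.Y →ₗ[R] t'.Y), g ∘ₗ t.u = t'.u ∘ₗ f →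
    ∃ φ : Hom t t', φ.f = f ∧ φ.g = g

theorem Contractible.completes {C C' : ProjCat} {t t' : Diagram R} (hc : t.Contractible)
    (ht : t.IsTriangle C) (ht' : t'.IsTriangle C') (he : t'.Exact) : Completes t t' := by
  intro f g hfg
  obtain ⟨Θ, Φ, Ψ, h1, h2, h3⟩ := hc
  have := ht.objX.projective
  have hfg' : ∀ p, g (t.u p) = t'.u (f p) := LinearMap.congr_fun hfg
  obtain ⟨k, hk⟩ := exists_comp_eq_of_forall_mem_range t'.w (f ∘ₗ t.w ∘ₗ Ψ) fun p =>
    (he.exact_wu _).1 (by simp [← hfg', ht.uw_apply])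
  have hk' : ∀ p, t'.w (k p) = f (t.w (Ψ p)) := LinearMap.congr_fun hk
  refine ⟨⟨f, g, t'.v ∘ₗ g ∘ₗ Φ + k ∘ₗ t.w, hfg, ?_, ?_⟩, rfl, rfl⟩
  · ext y
    have := congrArg (fun y => t'.v (g y)) (LinearMap.congr_fun h1 y)
    simp only [LinearMap.id_apply, LinearMap.add_apply, LinearMap.comp_apply, map_add, hfg',
      ht'.vu_apply, add_zero] at this
    simp [ht.wv_apply, this]
  · ext z
    have := congrArg f (LinearMap.congr_fun h3 (t.w z))
    simp only [LinearMap.id_apply, LinearMap.add_apply, LinearMap.comp_apply, 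
      ht.uw_apply, map_zero, zero_add] at this
    simp [ht'.wv_apply, hk', ← this]

theorem Completes.directSum {ι : Type u} {s : ι → Diagram R} {t' : Diagram R}
    (h : ∀ i, Completes (s i) t') : Completes (directSum s) t' := by
  classical
  intro f g hfg
  obtain ⟨F, rfl⟩ : ∃ F : (DirectSum ι fun i => (s i).X) →ₗ[R] t'.X, F = f := ⟨f, rfl⟩
  obtain ⟨G, rfl⟩ : ∃ G : (DirectSum ι fun i => (s i).Y) →ₗ[R] t'.Y, G = g := ⟨g, rfl⟩
  have hfg' : ∀ p, G (DirectSum.lmap (fun i => (s i).u) p) = t'.u (F p) := LinearMap.congr_fun hfg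
  choose φ hf hg using fun i => h i (F ∘ₗ DirectSum.lof R ι (fun i => (s i).X) i)
    (G ∘ₗ DirectSum.lof R ι (fun i => (s i).Y) i) (by
      ext p
      simp [← hfg'])
  let H : (DirectSum ι fun i => (s i).Z) →ₗ[R] t'.Z := DirectSum.toModule R ι t'.Z fun i => (φ i).h
  have h1 : H ∘ₗ DirectSum.lmap (fun i => (s i).v) = t'.v ∘ₗ G := by
    ext i y
    have := (φ i).v_apply y
    rw [hg] at this
    simpa [H] using this
  have h2 : F ∘ₗ DirectSum.lmap (fun i => (s i).w) = t'.w ∘ₗ H := by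
    ext i y
    have := (φ i).w_apply y
    rw [hf] at this
    simpa [H] using this
  exact ⟨⟨F, G, H, hfg, h1, h2⟩, rfl, rfl⟩

theorem Completes.of_isIso {t₁ t t' : Diagram R} (h : IsIso t₁ t) (ht : Completes t t') :
    Completes t₁ t' := by
  obtain ⟨φ, hf, hg, hh⟩ := h
  obtain ⟨ψ, h1, h2⟩ := exists_hom_inverse φ hf hg hh
  simp only [Hom.comp, Hom.id, Hom.mk.injEq] at h1 h2
  intro f g hfg
  obtain ⟨χ, hχf, hχg⟩ := ht (f ∘ₗ ψ.f) (g ∘ₗ ψ.g) (by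
    rw [LinearMap.comp_assoc, ψ.comm_u, ← LinearMap.comp_assoc, hfg, LinearMap.comp_assoc])
  refine ⟨χ.comp φ, ?_, ?_⟩
  · simp only [Hom.comp, hχf, LinearMap.comp_assoc, h1.1, LinearMap.comp_id]
  · simp only [Hom.comp, hχg, LinearMap.comp_assoc, h1.2.1, LinearMap.comp_id]

/-- An exact triangle is isomorphic to every exact triangle with the same first map to which
squares can be completed. -/
theorem Completes.isIso {X Y Z Z' : ModuleCat.{u} R} {u : X →ₗ[R] Y} {v : Y →ₗ[R] Z}
    {w : Z →ₗ[R] X} {v' : Y →ₗ[R] Z'} {w' : Z' →ₗ[R] X}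
    (h : Completes ⟨X, Y, Z, u, v, w⟩ ⟨X, Y, Z', u, v', w'⟩)
    (ht : Exact ⟨X, Y, Z, u, v, w⟩) (ht' : Exact ⟨X, Y, Z', u, v', w'⟩) :
    IsIso ⟨X, Y, Z, u, v, w⟩ ⟨X, Y, Z', u, v', w'⟩ := by
  obtain ⟨φ, hf, hg⟩ := h LinearMap.id LinearMap.id rfl
  have hf' : Function.Bijective φ.f := hf ▸ Function.bijective_id
  have hg' : Function.Bijective φ.g := hg ▸ Function.bijective_id
  exact ⟨φ, hf', hg', ht.bijective_h ht' φ hf' hg'⟩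

end Diagram

end Diagrams

/-! ### Generated triangles starting with a given map -/

section Generated

variable {R : Type u} [Ring R] {x : R}

namespace Diagram

theorem isTriangle_generating (hx : IsUniformizer x) (C : ProjCat) (a : R) :
    (generating x a).IsTriangle C where
  objX := C.isObj_self
  objY := C.isObj_self
  objZ := C.isObj_self
  vu := LinearMap.ext fun r : R => by
    change r * x * x = 0
    rw [mul_assoc, hx.mul_self, mul_zero]
  wv := LinearMap.ext fun r : R => by
    change r * x * (a * x) = 0
    rw [mul_assoc, ← mul_assoc x, hx.mul_mul_eq_zero, mul_zero]
  uw := LinearMap.ext fun r : R => by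
    change r * (a * x) * x = 0
    rw [mul_assoc, mul_assoc, hx.mul_self, mul_zero, mul_zero]

/-- The summands of the triangle on a map in normal form: a copy of `R = R → 0 → R` for each basis
vector sent to a basis vector, a generating triangle for each basis vector sent to a multiple of
`x`, and translates of `R = R → 0 → R` for the remaining basis vectors of source and target. -/
def normalSummand (x a : R) (I J K L : Type u) : I ⊕ J ⊕ K ⊕ L → Diagram R
  | .inl _ => identity (ModuleCat.of R R)
  | .inr (.inl _) => generating x a
  | .inr (.inr (.inl _)) => (identity (ModuleCat.of R R)).translate
  | .inr (.inr (.inr _)) => (identity (ModuleCat.of R R)).translate.translate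

theorem isTriangle_normalSummand (hx : IsUniformizer x) (C : ProjCat) (a : R) {I J K L : Type u}
    (i : I ⊕ J ⊕ K ⊕ L) : (normalSummand x a I J K L i).IsTriangle C ∧
      ((normalSummand x a I J K L i).Contractible ∨ normalSummand x a I J K L i = generating x a) :=
  have h := isTriangle_identity C.isObj_self
  have hc := contractible_identity (ModuleCat.of R R)
  match i with
  | .inl _ => ⟨h, .inl hc⟩
  | .inr (.inl _) => ⟨isTriangle_generating hx C a, .inr rfl⟩
  | .inr (.inr (.inl _)) => ⟨h.translate, .inl hc.translate⟩
  | .inr (.inr (.inr _)) => ⟨h.translate.translate, .inl hc.translate.translate⟩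

/-- A map from a direct sum is bijective as soon as it matches a basis of its target with
generators of the nonzero summands. -/
theorem bijective_toModule_of_basis {ι κ X : Type*} [DecidableEq ι] {M : ι → Type*}
    [∀ i, AddCommGroup (M i)] [∀ i, Module R (M i)] [AddCommGroup X] [Module R X]
    (b : Module.Basis κ R X) (c : ∀ i, M i →ₗ[R] X) (σ : κ → ι) (e : ∀ k, M (σ k))
    (hc : ∀ k, c (σ k) (e k) = b k) (hM : ∀ i (m : M i), m = 0 ∨ ∃ (k : κ) (r : R),
      DirectSum.lof R ι M i m = r • DirectSum.lof R ι M (σ k) (e k)) :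
    Function.Bijective (DirectSum.toModule R ι X c) := by
  let G : X →ₗ[R] DirectSum ι M := b.constr ℕ fun k => DirectSum.lof R ι M (σ k) (e k)
  have h1 : DirectSum.toModule R ι X c ∘ₗ G = LinearMap.id :=
    b.ext fun k => by simp [G, hc]
  have h2 : G ∘ₗ DirectSum.toModule R ι X c = LinearMap.id := by
    refine DirectSum.linearMap_ext R fun i => LinearMap.ext fun m => ?_
    rcases hM i m with rfl | ⟨k, r, h⟩
    · simp
    · simp [h, hc, G]
  exact ⟨Function.LeftInverse.injective (g := G) (LinearMap.congr_fun h2),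
    Function.RightInverse.surjective (g := G) (LinearMap.congr_fun h1)⟩

/-- Every map in the category `C` is the first map of a triangle generated by `x` and `a`. -/
theorem exists_mem_generated [IsLocalRing R] (hx : IsUniformizer x) {C : ProjCat} (a : R)
    {X Y : ModuleCat.{u} R} (hX : C.IsObj X) (hY : C.IsObj Y) (u : X →ₗ[R] Y) :
    ∃ (Z : ModuleCat.{u} R) (v : Y →ₗ[R] Z) (w : Z →ₗ[R] X),
      (⟨X, Y, Z, u, v, w⟩ : Diagram R) ∈ Generated C x a := by
  classical
  have := hX.projective
  have := hY.projective
  obtain ⟨I, J, K, L, bX, bY, hI, hJ, hK⟩ := hx.exists_normalForm u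
  let s := normalSummand x a I J K L
  have hι : C.IsIndex (I ⊕ J ⊕ K ⊕ L) := by
    cases C
    · trivial
    · have := hX.2
      have := hY.2
      have h1 := Module.Finite.finite_basis bX
      have h2 := Module.Finite.finite_basis bY
      have hI : Finite I := Finite.of_injective (Sum.inl : I → I ⊕ J ⊕ K) Sum.inl_injective
      have hJK : Finite (J ⊕ K) :=
        Finite.of_injective (Sum.inr : J ⊕ K → I ⊕ J ⊕ K) Sum.inr_injective
      have hJL : Finite (J ⊕ L) :=
        Finite.of_injective (Sum.inr : J ⊕ L → I ⊕ J ⊕ L) Sum.inr_injective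
      have hJ : Finite J := Finite.of_injective (Sum.inl : J → J ⊕ K) Sum.inl_injective
      have hK : Finite K := Finite.of_injective (Sum.inr : K → J ⊕ K) Sum.inr_injective
      have hL : Finite L := Finite.of_injective (Sum.inr : L → J ⊕ L) Sum.inr_injective
      exact inferInstanceAs (Finite (I ⊕ J ⊕ K ⊕ L))
  have hs := isTriangle_normalSummand hx C a (I := I) (J := J) (K := K) (L := L)
  let cX : ∀ i, (s i).X →ₗ[R] X
    | .inl i => LinearMap.toSpanSingleton R X (bX (.inl i))
    | .inr (.inl j) => LinearMap.toSpanSingleton R X (bX (.inr (.inl j)))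
    | .inr (.inr (.inl k)) => LinearMap.toSpanSingleton R X (bX (.inr (.inr k)))
    | .inr (.inr (.inr _)) => 0
  let cY : ∀ i, (s i).Y →ₗ[R] Y
    | .inl i => LinearMap.toSpanSingleton R Y (bY (.inl i))
    | .inr (.inl j) => LinearMap.toSpanSingleton R Y (bY (.inr (.inl j)))
    | .inr (.inr (.inl _)) => 0
    | .inr (.inr (.inr l)) => LinearMap.toSpanSingleton R Y (bY (.inr (.inr l)))
  let σX : I ⊕ J ⊕ K → I ⊕ J ⊕ K ⊕ L
    | .inl i => .inl i
    | .inr (.inl j) => .inr (.inl j)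
    | .inr (.inr k) => .inr (.inr (.inl k))
  let σY : I ⊕ J ⊕ L → I ⊕ J ⊕ K ⊕ L
    | .inl i => .inl i
    | .inr (.inl j) => .inr (.inl j)
    | .inr (.inr k) => .inr (.inr (.inr k))
  let eX : ∀ k, (s (σX k)).X
    | .inl _ => (1 : R)
    | .inr (.inl _) => (1 : R)
    | .inr (.inr _) => (1 : R)
  let eY : ∀ k, (s (σY k)).Y
    | .inl _ => (1 : R)
    | .inr (.inl _) => (1 : R)
    | .inr (.inr _) => (1 : R)
  have keyX : ∀ i (e m : (s i).X) (r : R), m = r • e →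
      DirectSum.lof R _ (fun i => (s i).X) i m = r • DirectSum.lof R _ (fun i => (s i).X) i e := by
    rintro i e m r rfl
    exact map_smul _ _ _
  have hbX : Function.Bijective (DirectSum.toModule R _ X cX) := by
    refine bijective_toModule_of_basis bX cX σX eX ?_ ?_
    · rintro (i | j | k) <;> exact one_smul R _
    · rintro (i | j | k | l) m
      · exact .inr ⟨.inl i, m, keyX (.inl i) (1 : R) m m (@mul_one R _ m).symm⟩
      · exact .inr ⟨.inr (.inl j), m, keyX (.inr (.inl j)) (1 : R) m m (@mul_one R _ m).symm⟩
      · exact .inr ⟨.inr (.inr k), m, keyX (.inr (.inr (.inl k))) (1 : R) m m (@mul_one R _ m).symm⟩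
      · exact .inl (Subsingleton.elim (α := PUnit) _ _)
  have keyY : ∀ i (e m : (s i).Y) (r : R), m = r • e →
      DirectSum.lof R _ (fun i => (s i).Y) i m = r • DirectSum.lof R _ (fun i => (s i).Y) i e := by
    rintro i e m r rfl
    exact map_smul _ _ _
  have hbY : Function.Bijective (DirectSum.toModule R _ Y cY) := by
    refine bijective_toModule_of_basis bY cY σY eY ?_ ?_
    · rintro (i | j | k) <;> exact one_smul R _
    · rintro (i | j | k | l) m
      · exact .inr ⟨.inl i, m, keyY (.inl i) (1 : R) m m (@mul_one R _ m).symm⟩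
      · exact .inr ⟨.inr (.inl j), m, keyY (.inr (.inl j)) (1 : R) m m (@mul_one R _ m).symm⟩
      · exact .inl (Subsingleton.elim (α := PUnit) _ _)
      · exact .inr ⟨.inr (.inr l), m, keyY (.inr (.inr (.inr l))) (1 : R) m m (@mul_one R _ m).symm⟩
  let FX := LinearEquiv.ofBijective _ hbX
  let FY := LinearEquiv.ofBijective _ hbY
  have hu : u ∘ₗ DirectSum.toModule R _ X cX =
      DirectSum.toModule R _ Y cY ∘ₗ DirectSum.lmap (fun i => (s i).u) := by
    refine DirectSum.linearMap_ext R fun i => ?_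
    rcases i with i | j | k | l
    · refine LinearMap.ext fun m => ?_
      simp only [LinearMap.comp_apply, DirectSum.lmap_lof, DirectSum.toModule_lof]
      obtain ⟨m, rfl⟩ : ∃ n : R, n = m := ⟨m, rfl⟩
      change u (m • bX (.inl i)) = m • bY (.inl i)
      rw [map_smul, hI]
    · refine LinearMap.ext fun m => ?_
      simp only [LinearMap.comp_apply, DirectSum.lmap_lof, DirectSum.toModule_lof]
      obtain ⟨m, rfl⟩ : ∃ n : R, n = m := ⟨m, rfl⟩
      change u (m • bX (.inr (.inl j))) = (m * x) • bY (.inr (.inl j))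
      rw [map_smul, hJ, mul_smul]
    · refine LinearMap.ext fun m => ?_
      simp only [LinearMap.comp_apply, DirectSum.lmap_lof, DirectSum.toModule_lof]
      obtain ⟨m, rfl⟩ : ∃ n : R, n = m := ⟨m, rfl⟩
      change u (m • bX (.inr (.inr k))) = 0
      rw [map_smul, hK, smul_zero]
    · refine LinearMap.ext fun m => ?_
      simp only [LinearMap.comp_apply, DirectSum.lmap_lof, DirectSum.toModule_lof]
      exact (map_zero u).trans (map_zero _).symm
  have hu : ∀ p, u (FX p) = FY (DirectSum.lmap (fun i => (s i).u) p) := LinearMap.congr_fun hu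
  have hFX : ∀ p, FX (FX.symm p) = p := FX.apply_symm_apply
  have hFY : ∀ p, FY (FY.symm p) = p := FY.apply_symm_apply
  have hFX' : ∀ p, FX.symm (FX p) = p := FX.symm_apply_apply
  have hFY' : ∀ p, FY.symm (FY p) = p := FY.symm_apply_apply
  have hT := IsTriangle.directSum hι fun i => (hs i).1
  let v : Y →ₗ[R] (directSum s).Z := DirectSum.lmap (fun i => (s i).v) ∘ₗ FY.symm.toLinearMap
  let w : (directSum s).Z →ₗ[R] X := FX.toLinearMap ∘ₗ DirectSum.lmap (fun i => (s i).w)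
  refine ⟨(directSum s).Z, v, w, ⟨hX, hY, hT.objZ, ?_, ?_, ?_⟩, _, s, hι, hs,
    ⟨FX.symm.toLinearMap, FY.symm.toLinearMap, LinearMap.id, ?_, ?_, ?_⟩, FX.symm.bijective,
      FY.symm.bijective, Function.bijective_id⟩
  · ext p
    obtain ⟨p, rfl⟩ := FX.surjective p
    change DirectSum.lmap (fun i => (s i).v) (FY.symm (u (FX p))) = 0
    rw [hu, hFY']
    exact hT.vu_apply p
  · ext y
    change FX (DirectSum.lmap (fun i => (s i).w)
      (DirectSum.lmap (fun i => (s i).v) (FY.symm y))) = 0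
    rw [← map_zero FX]
    exact congrArg FX (hT.wv_apply _)
  · refine LinearMap.ext fun z : DirectSum _ fun i => (s i).Z => ?_
    change u (FX (DirectSum.lmap (fun i => (s i).w) z)) = 0
    rw [hu, ← map_zero FY]
    exact congrArg FY (hT.uw_apply z)
  · ext p
    obtain ⟨p, rfl⟩ := FX.surjective p
    change FY.symm (u (FX p)) = DirectSum.lmap (fun i => (s i).u) (FX.symm (FX p))
    rw [hu, hFY', hFX']
  · rfl
  · refine LinearMap.ext fun z : DirectSum _ fun i => (s i).Z => ?_
    exact hFX' _

end Diagram

end Generated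

/-! ### The generator of a triangulation -/

/-- The conditions on `a` under which `x` and `a` generate a triangulation. In terms of the class
`r` of `a` and of `σ_x` they say that `r ≠ 0`, that the residue skew field has characteristic two,
that `σ_x r = r` and that `r σ_x³(t) = t r` for all `t`. -/
structure IsAdmissible {R : Type u} [Ring R] (x a : R) : Prop where
  notMem : a ∉ maxIdeal R
  two_mem : (2 : R) ∈ maxIdeal R
  comm : x * a = a * x
  twist : ∀ f g h : R, x * g = f * x → x * h = g * x → a * x * f = h * (a * x)

section Triangulation

variable {R : Type u} [Ring R] {x : R}

namespace Diagram

theorem generating_congr (hx : IsUniformizer x) {a b : R} (h : residue R a = residue R b) :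
    generating x a = generating x b := by
  have : a * x = b * x := by
    rw [← sub_eq_zero, ← sub_mul]
    exact hx.mul_left_eq_zero_iff.2 (residue_eq_iff.1 h)
  rw [generating, generating, this]

theorem exact_generating [IsLocalRing R] (hx : IsUniformizer x) {a : R} (ha : a ∉ maxIdeal R) :
    (generating x a).Exact := by
  obtain ⟨c, rfl⟩ : IsUnit a := not_not.1 fun h => ha (mem_maxIdeal_iff.2 h)
  have hc : ∀ r : R, r * (c * x) = 0 ↔ r ∈ maxIdeal R := fun r => by
    rw [← mul_assoc, hx.mul_left_eq_zero_iff, mem_maxIdeal_iff, mem_maxIdeal_iff,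
      Units.isUnit_mul_units]
  have hr : ∀ r : R, r ∈ maxIdeal R ↔ ∃ s : R, s * x = r := fun r =>
    ⟨fun h => (hx.exists_eq_mul h).imp fun _ h => h.symm,
      fun ⟨s, hs⟩ => hs ▸ (maxIdeal R).mul_mem_left s hx.mem⟩
  have hr' : ∀ r : R, r ∈ maxIdeal R ↔ ∃ s : R, s * (c * x) = r := fun r => by
    rw [hr]
    exact ⟨fun ⟨s, hs⟩ => ⟨s * ↑c⁻¹, by rw [← mul_assoc, Units.inv_mul_cancel_right, hs]⟩,
      fun ⟨s, hs⟩ => ⟨s * c, by rw [mul_assoc, hs]⟩⟩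
  exact ⟨fun r : R => hx.mul_left_eq_zero_iff.trans (hr r), fun r : R => (hc r).trans (hr r),
    fun r : R => hx.mul_left_eq_zero_iff.trans (hr' r)⟩

theorem generating_mem_generated (hx : IsUniformizer x) (C : ProjCat) (a : R) :
    generating x a ∈ Generated C x a := by
  refine ⟨isTriangle_generating hx C a, PUnit, fun _ => generating x a, ?_,
    fun _ => ⟨isTriangle_generating hx C a, .inr rfl⟩, IsIso.symm ?_⟩
  · cases C
    · trivial
    · exact inferInstanceAs (Finite PUnit)
  · let e := DirectSum.lid R R PUnit.{u + 1}
    have he : ∀ p, e p = p default := DirectSum.lid_apply R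
    have hcomm : ∀ b : R, e.toLinearMap ∘ₗ
        DirectSum.lmap (fun _ : PUnit.{u + 1} => LinearMap.toSpanSingleton R R b) =
          LinearMap.toSpanSingleton R R b ∘ₗ e.toLinearMap := fun b => LinearMap.ext fun p => by
      rw [LinearMap.comp_apply, LinearMap.comp_apply, LinearEquiv.coe_coe, he, he,
        DirectSum.lmap_apply]
    exact ⟨⟨e.toLinearMap, e.toLinearMap, e.toLinearMap, hcomm x, hcomm x, hcomm (a * x)⟩,
      e.bijective, e.bijective, e.bijective⟩

end Diagram

open Diagram

namespace Triangulation

variable {C : ProjCat} (T : Triangulation R C)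

theorem completes {t t' : Diagram R} (ht : t ∈ T.dist) (ht' : t' ∈ T.dist) : Completes t t' :=
  fun f g h => (T.exists_cone t ht t' ht' f g h).imp fun _ h => ⟨h.1, h.2.1⟩

theorem translate_mem {t : Diagram R} (ht : t ∈ T.dist) : t.translate ∈ T.dist :=
  (T.translate_mem_iff t (T.isTriangle t ht)).1 ht

/-- Distinguished triangles are exact: an element `y` with `v y = 0` is a morphism from the
translate `R → 0 → R` of the triangle `R = R → 0`, and a completion of it provides a preimage. -/
theorem exists_u_eq {t : Diagram R} (ht : t ∈ T.dist) {y : t.Y} (hy : t.v y = 0) :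
    ∃ p, t.u p = y := by
  obtain ⟨φ, hf, -⟩ := T.completes (T.translate_mem (T.identity_mem _ C.isObj_self))
    (T.translate_mem ht) (LinearMap.toSpanSingleton R t.Y y) (0 : PUnit.{u + 1} →ₗ[R] t.Z) (by
      refine LinearMap.ext fun r : R => ?_
      change 0 = t.v (r • y)
      rw [map_smul, hy, smul_zero])
  have h := φ.w_apply (1 : R)
  rw [hf] at h
  change (-1 : R) • y = -t.u (φ.h (1 : R)) at h
  rw [neg_smul, one_smul, neg_inj] at h
  exact ⟨_, h.symm⟩

theorem exact {t : Diagram R} (ht : t ∈ T.dist) : t.Exact := by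
  have h := T.isTriangle t ht
  refine ⟨fun y => ⟨fun hy => T.exists_u_eq ht hy, ?_⟩,
    fun z => ⟨fun hz => T.exists_u_eq (T.translate_mem ht) hz, ?_⟩,
    fun p => ⟨fun hp => T.exists_u_eq (T.translate_mem (T.translate_mem ht)) (y := p) ?_, ?_⟩⟩
  · rintro ⟨p, rfl⟩; exact h.vu_apply p
  · rintro ⟨p, rfl⟩; exact h.wv_apply p
  · change -t.u p = 0
    rw [hp, neg_zero]
  · rintro ⟨p, rfl⟩; exact h.uw_apply p

/-- A triangulation is determined by any of its triangles `R → R → R → R` with maps `x`, `x`,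
`a x`. -/
theorem dist_eq_generated [IsLocalRing R] (hx : IsUniformizer x) {a : R} (ha : a ∉ maxIdeal R)
    (h : generating x a ∈ T.dist) : T.dist = Generated C x a := by
  have hsub : Generated C x a ⊆ T.dist := by
    rintro t ⟨ht, ι, s, hι, hs, hts⟩
    have hex : t.Exact := Exact.of_isIso hts <| Exact.directSum fun i => by
      rcases (hs i).2 with hc | hg
      · exact hc.exact (hs i).1
      · exact hg ▸ exact_generating hx ha
    obtain ⟨Z, v, w, hT⟩ := T.exists_triangle t.X t.Y ht.objX ht.objY t.u
    have hc : Completes t ⟨t.X, t.Y, Z, t.u, v, w⟩ := Completes.of_isIso hts <|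
      Completes.directSum fun i => by
        rcases (hs i).2 with hc | hg
        · exact hc.completes (hs i).1 (T.isTriangle _ hT) (T.exact hT)
        · exact T.completes (hg ▸ h) hT
    exact T.iso_closed _ hT _ ht (Completes.isIso hc hex (T.exact hT)).symm
  refine Set.Subset.antisymm (fun t ht => ?_) hsub
  have htt := T.isTriangle t ht
  obtain ⟨Z, v, w, hG⟩ := exists_mem_generated hx a htt.objX htt.objY t.u
  have hG' := hsub hG
  obtain ⟨h1, ι, s, hι, hs, hts⟩ := hG
  exact ⟨htt, ι, s, hι, hs,
    (Completes.isIso (T.completes ht hG') (T.exact ht) (T.exact hG')).trans hts⟩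

/-- Every triangulation contains some triangle `R → R → R → R` with maps `x`, `x`, `a x`, where `a`
is a unit: in a distinguished triangle `R → R → Z → R` on `x`, exactness makes `Z` free on an
element `e` with `v 1 = x e` and `w e = a x`. -/
theorem exists_generating_mem [IsLocalRing R] (hx : IsUniformizer x) :
    ∃ a ∉ maxIdeal R, generating x a ∈ T.dist := by
  obtain ⟨Z, v, w, hT⟩ := T.exists_triangle _ _ C.isObj_self C.isObj_self
    (LinearMap.toSpanSingleton R R x)
  obtain ⟨v, rfl⟩ : ∃ v' : R →ₗ[R] Z, v' = v := ⟨v, rfl⟩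
  obtain ⟨w, rfl⟩ : ∃ w' : Z →ₗ[R] R, w' = w := ⟨w, rfl⟩
  have ht := T.isTriangle _ hT
  have hex := T.exact hT
  have := ht.objZ.projective
  have hvx : ∀ r : R, v (r * x) = 0 := ht.vu_apply
  have hv : ∀ r : R, v r = r • v 1 := fun r => by rw [← map_smul, smul_eq_mul, mul_one]
  obtain ⟨e, he⟩ := hx.exists_eq_smul (y := v 1) (by rw [← hv, ← one_mul x, hvx])
  obtain ⟨b, hb⟩ := hx.exists_eq_mul (s := w e) (hx.mul_right_eq_zero_iff.1 (by
    rw [← smul_eq_mul, ← map_smul, ← he]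
    exact ht.wv_apply (1 : R)))
  have hbm : b ∉ maxIdeal R := fun hbm => by
    obtain ⟨r, hr⟩ := (hex.exact_vw e).1 (hb.trans (hx.mul_left_eq_zero_iff.2 hbm))
    have hr : v r = e := hr
    have h0 : v 1 = 0 := by rw [he, ← hr, hv r, he, hx.smul_smul_smul]
    obtain ⟨s, hs⟩ := (hex.exact_uv (1 : R)).1 h0
    have hs : s * x = 1 := hs
    have h1 : (1 : R) ∈ maxIdeal R := hs ▸ (maxIdeal R).mul_mem_left s hx.mem
    exact mem_maxIdeal_iff.1 h1 isUnit_one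
  refine ⟨b, hbm, T.iso_closed _ hT _ (isTriangle_generating hx C b) (IsIso.symm ?_)⟩
  let φ : Hom (generating x b) ⟨_, _, Z, LinearMap.toSpanSingleton R R x, v, w⟩ :=
    { f := LinearMap.id
      g := LinearMap.id
      h := LinearMap.toSpanSingleton R Z e
      comm_u := rfl
      comm_v := LinearMap.ext fun r : R => by
        change (r * x) • e = v r
        rw [hv, he, mul_smul]
      comm_w := LinearMap.ext fun r : R => by
        change r * (b * x) = w (r • e)
        rw [map_smul, hb, smul_eq_mul] }
  exact ⟨φ, Function.bijective_id, Function.bijective_id,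
    (exact_generating hx hbm).bijective_h hex φ Function.bijective_id Function.bijective_id⟩

theorem residue_eq_of_generating_mem (hx : IsUniformizer x) {a b : R}
    (ha : generating x a ∈ T.dist) (hb : generating x b ∈ T.dist) :
    residue R a = residue R b := by
  obtain ⟨φ, hf, hg⟩ := T.completes ha hb LinearMap.id LinearMap.id rfl
  obtain ⟨h, hh⟩ : ∃ h : R →ₗ[R] R, h = φ.h := ⟨φ.h, rfl⟩
  have h1 := φ.v_apply (1 : R)
  have h2 := φ.w_apply (1 : R)
  rw [hf, ← hh] at h2
  rw [hg, ← hh] at h1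
  change h (1 * x) = 1 * x at h1
  change 1 * (a * x) = h 1 * (b * x) at h2
  have h3 : x * h 1 = x := by
    rw [← smul_eq_mul, ← map_smul, smul_eq_mul, mul_one]
    simpa using h1
  have h4 : residue R (h 1) = 1 := by
    rw [← map_one (residue R), residue_eq_iff, ← hx.mul_right_eq_zero_iff, mul_sub, h3, mul_one,
      sub_self]
  have h5 : residue R a = residue R (h 1 * b) := by
    rw [residue_eq_iff, ← hx.mul_left_eq_zero_iff, sub_mul, mul_assoc, ← h2, one_mul, sub_self]
  rw [h5, map_mul, h4, one_mul]

/-- Completing squares from the triangle given by `a` to itself yields the twist condition, and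
completing the identity square to its translate yields `x a = -a x`; together they force
`2 ∈ 𝔪`. -/
theorem isAdmissible_of_generating_mem [IsLocalRing R] (hx : IsUniformizer x) {a : R}
    (hm : a ∉ maxIdeal R) (ha : generating x a ∈ T.dist) : IsAdmissible x a := by
  have h1 : ∀ f g h : R, x * g = f * x → x * h = g * x → a * x * f = h * (a * x) := by
    intro f g h hfg hgh
    obtain ⟨φ, hf, hg⟩ := T.completes ha ha (LinearMap.toSpanSingleton R R f)
      (LinearMap.toSpanSingleton R R g) (LinearMap.ext fun r : R => by
        change r * x * g = r * f * x
        rw [mul_assoc, mul_assoc, hfg])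
    obtain ⟨k, hk⟩ : ∃ k : R →ₗ[R] R, k = φ.h := ⟨φ.h, rfl⟩
    have h1 := φ.v_apply (1 : R)
    have h2 := φ.w_apply (1 : R)
    rw [hf, ← hk] at h2
    rw [hg, ← hk] at h1
    change k (1 * x) = 1 * g * x at h1
    change 1 * (a * x) * f = k 1 * (a * x) at h2
    have h3 : x * k 1 = g * x := by
      rw [← smul_eq_mul, ← map_smul, smul_eq_mul, mul_one]
      simpa using h1
    have h4 : h - k 1 ∈ maxIdeal R := by
      rw [← hx.mul_right_eq_zero_iff, mul_sub, h3, hgh, sub_self]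
    rw [one_mul] at h2
    rw [h2, eq_comm, ← sub_eq_zero, ← sub_mul, ← mul_assoc, hx.mul_left_eq_zero_iff]
    exact (maxIdeal R).mul_mem_right a h4
  have h2 : x * a = -(a * x) := by
    obtain ⟨φ, hf, hg⟩ := T.completes ha (T.translate_mem ha) LinearMap.id LinearMap.id rfl
    obtain ⟨k, hk⟩ : ∃ k : R →ₗ[R] R, k = φ.h := ⟨φ.h, rfl⟩
    have h1 := φ.v_apply (1 : R)
    have h2 := φ.w_apply (1 : R)
    rw [hf, ← hk] at h2
    rw [hg, ← hk] at h1
    change k (1 * x) = 1 * (a * x) at h1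
    change 1 * (a * x) = -(k 1 * x) at h2
    have h3 : x * k 1 = a * x := by
      rw [← smul_eq_mul, ← map_smul, smul_eq_mul, mul_one]
      simpa using h1
    have h4 : k 1 + a ∈ maxIdeal R := by
      rw [← hx.mul_left_eq_zero_iff, add_mul, ← one_mul (a * x), h2, add_neg_cancel]
    rw [← hx.mul_right_eq_zero_iff, mul_add, h3] at h4
    exact eq_neg_of_add_eq_zero_right h4
  have h3 : (2 : R) ∈ maxIdeal R := by
    -- The twist condition for `h = a` reads `a a x = -(a a x)`, and `a` is a unit.
    have h := h1 a (-a) a (by rw [mul_neg, h2, neg_neg]) (by rw [h2, neg_mul])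
    rw [mul_assoc, h2, mul_neg, neg_eq_iff_add_eq_zero, ← two_mul, ← mul_assoc, ← mul_assoc,
      hx.mul_left_eq_zero_iff, mem_maxIdeal_iff, mul_assoc] at h
    have hu : IsUnit a := not_not.1 fun h => hm (mem_maxIdeal_iff.2 h)
    rw [mem_maxIdeal_iff]
    exact fun h2 => h (h2.mul (hu.mul hu))
  refine ⟨hm, h3, ?_, h1⟩
  rw [h2, neg_eq_iff_add_eq_zero, ← two_mul, ← mul_assoc, hx.mul_left_eq_zero_iff]
  exact (maxIdeal R).mul_mem_right a h3

theorem isInducedBy_residue_iff [IsLocalRing R] (hx : IsUniformizer x) {a : R} :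
    T.IsInducedBy x (residue R a) ↔ a ∉ maxIdeal R ∧ generating x a ∈ T.dist := by
  constructor
  · rintro ⟨h0, h⟩
    exact ⟨fun ha => h0 (residue_eq_zero_iff.2 ha),
      h a rfl ▸ generating_mem_generated hx C a⟩
  · rintro ⟨ha, h⟩
    refine ⟨fun h0 => ha (residue_eq_zero_iff.1 h0), fun b hb => ?_⟩
    refine T.dist_eq_generated hx (fun hbm => ha ?_) (generating_congr hx hb ▸ h)
    rwa [← residue_eq_zero_iff, ← hb, residue_eq_zero_iff]

theorem existsUnique_isInducedBy [IsLocalRing R] (hx : IsUniformizer x) :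
    ∃! r : ResidueSkewField R, T.IsInducedBy x r := by
  obtain ⟨a, ha, h⟩ := T.exists_generating_mem hx
  refine ⟨residue R a, (T.isInducedBy_residue_iff hx).2 ⟨ha, h⟩, fun r hr => ?_⟩
  obtain ⟨b, rfl⟩ := residue_surjective r
  exact T.residue_eq_of_generating_mem hx ((T.isInducedBy_residue_iff hx).1 hr).2 h

end Triangulation

end Triangulation

/-! ### Intrinsic description of the generated triangles -/

section Saturated

variable {R : Type u} [Ring R] {x a : R}

theorem IsAdmissible.neg_mul (hx : IsUniformizer x) (ha : IsAdmissible x a) :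
    -(a * x) = a * x := by
  rw [neg_eq_iff_add_eq_zero, ← two_mul, ← mul_assoc, hx.mul_left_eq_zero_iff]
  exact (maxIdeal R).mul_mem_right a ha.two_mem

theorem IsUniformizer.smul_mul_smul (hx : IsUniformizer x) {M : Type*} [AddCommGroup M]
    [Module R M] (y : M) : (a * x) • x • y = 0 := by
  rw [mul_smul, hx.smul_smul_self, smul_zero]

theorem IsUniformizer.smul_mul_smul' (hx : IsUniformizer x) {M : Type*} [AddCommGroup M]
    [Module R M] (y : M) : x • (a * x) • y = 0 := by
  rw [mul_smul, hx.smul_smul_smul]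

namespace Diagram

/-- A triangle is saturated if it is exact and every square from the first map of the generating
triangle `R → R → R → R` to its first map, which amounts to elements `p` and `q` with `u p = x q`,
extends to a morphism of triangles. This does not refer to a decomposition, and it singles out the
triangles generated by `x` and `a`; see `mem_generated_iff`. -/
structure Saturated (x a : R) (t : Diagram R) : Prop where
  exact : t.Exact
  exists_extension : ∀ (p : t.X) (q : t.Y), t.u p = x • q →
    ∃ s, t.v q = x • s ∧ t.w s = (a * x) • p

theorem Saturated.completes_generating {t : Diagram R} (ht : t.Saturated x a) :
    Completes (generating x a) t := by
  intro f g hfg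
  obtain ⟨f, rfl⟩ : ∃ f' : R →ₗ[R] t.X, f' = f := ⟨f, rfl⟩
  obtain ⟨g, rfl⟩ : ∃ g' : R →ₗ[R] t.Y, g' = g := ⟨g, rfl⟩
  have hf : ∀ r : R, f r = r • f 1 := fun r => by rw [← map_smul, smul_eq_mul, mul_one]
  have hg : ∀ r : R, g r = r • g 1 := fun r => by rw [← map_smul, smul_eq_mul, mul_one]
  have h1 : g (1 * x) = t.u (f 1) := LinearMap.congr_fun hfg (1 : R)
  obtain ⟨s, hs, hs'⟩ := ht.exists_extension (f 1) (g 1) (by rw [← h1, one_mul, hg x])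
  refine ⟨⟨f, g, LinearMap.toSpanSingleton R t.Z s, hfg, LinearMap.ext fun r : R => ?_,
    LinearMap.ext fun r : R => ?_⟩, rfl, rfl⟩
  · change (r * x) • s = t.v (g r)
    rw [hg, map_smul, hs, mul_smul]
  · change f (r * (a * x)) = t.w (r • s)
    rw [hf, map_smul, hs', mul_smul]

theorem saturated_generating [IsLocalRing R] (hx : IsUniformizer x) (ha : IsAdmissible x a) :
    (generating x a).Saturated x a := by
  refine ⟨exact_generating hx ha.notMem, fun (p : R) (q : R) (h : p * x = x * q) => ?_⟩
  obtain ⟨s, hs⟩ := hx.exists_right q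
  exact ⟨s, hs, (ha.twist p q s h.symm hs.symm).symm⟩

theorem Contractible.saturated (hx : IsUniformizer x) {C : ProjCat} {t : Diagram R}
    (hc : t.Contractible) (ht : t.IsTriangle C) : t.Saturated x a := by
  refine ⟨hc.exact ht, fun p q hpq => ?_⟩
  have := ht.objZ.projective
  obtain ⟨Θ, Φ, Ψ, h1, h2, h3⟩ := hc
  obtain ⟨s, hs⟩ := hx.exists_eq_smul (y := t.v q) (by rw [← map_smul, ← hpq, ht.vu_apply])
  refine ⟨t.v (Φ s) + (a * x) • Ψ p, ?_, ?_⟩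
  · have h := congrArg t.v (LinearMap.congr_fun h1 q)
    simp only [LinearMap.id_apply, LinearMap.add_apply, LinearMap.comp_apply, map_add,
      ht.vu_apply, add_zero] at h
    rw [smul_add, hx.smul_mul_smul', add_zero, h, hs, map_smul, map_smul]
  · have h := congrArg ((a * x) • ·) (LinearMap.congr_fun h3 p)
    simp only [LinearMap.id_apply, LinearMap.add_apply, LinearMap.comp_apply, hpq, map_smul,
      smul_add, hx.smul_mul_smul, zero_add] at h
    rw [map_add, ht.wv_apply, zero_add, map_smul, h]

theorem Saturated.directSum {ι : Type u} {s : ι → Diagram R} (hs : ∀ i, (s i).Saturated x a) :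
    (directSum s).Saturated x a := by
  refine ⟨Exact.directSum fun i => (hs i).exact, fun (p : DirectSum ι fun i => (s i).X)
    (q : DirectSum ι fun i => (s i).Y) h => ?_⟩
  have h : ∀ i, (s i).u (p i) = x • q i := fun i =>
    DFunLike.congr_fun (F := DirectSum ι fun i => (s i).Y) h i
  obtain ⟨z, hz⟩ := exists_directSum_of_forall
    (fun i z => (s i).v (q i) = x • z ∧ (s i).w z = (a * x) • p i) _
    ((finite_setOf_apply_ne_zero p).union (finite_setOf_apply_ne_zero q)) (fun i hi => by
      simp only [Set.mem_union, Set.mem_ofPred_eq, not_or, not_not] at hi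
      simp [hi.1, hi.2]) fun i => (hs i).exists_extension _ _ (h i)
  exact ⟨z, DirectSum.ext fun i => (hz i).1, DirectSum.ext fun i => (hz i).2⟩

theorem Saturated.of_isIso {t t' : Diagram R} (h : IsIso t t') (ht : t'.Saturated x a) :
    t.Saturated x a := by
  refine ⟨ht.exact.of_isIso h, fun p q hpq => ?_⟩
  obtain ⟨φ, hf, hg, hh⟩ := h
  obtain ⟨s, hs, hs'⟩ := ht.exists_extension (φ.f p) (φ.g q)
    (by rw [← φ.u_apply, hpq, map_smul])
  obtain ⟨s, rfl⟩ := hh.2 s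
  refine ⟨s, hh.1 ?_, hf.1 ?_⟩
  · rw [φ.v_apply, hs, map_smul]
  · rw [φ.w_apply, hs', map_smul]

theorem saturated_of_mem_generated [IsLocalRing R] (hx : IsUniformizer x)
    (ha : IsAdmissible x a) {C : ProjCat} {t : Diagram R} (ht : t ∈ Generated C x a) :
    t.Saturated x a := by
  obtain ⟨-, ι, s, -, hs, hts⟩ := ht
  refine Saturated.of_isIso hts (Saturated.directSum fun i => ?_)
  rcases (hs i).2 with hc | hg
  · exact hc.saturated hx (hs i).1
  · exact hg ▸ saturated_generating hx ha

theorem Saturated.completes_of_mem_generated {C C' : ProjCat} {t t' : Diagram R}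
    (ht : t ∈ Generated C x a) (htr : t'.IsTriangle C') (ht' : t'.Saturated x a) :
    Completes t t' := by
  obtain ⟨-, ι, s, -, hs, hts⟩ := ht
  refine Completes.of_isIso hts (Completes.directSum fun i => ?_)
  rcases (hs i).2 with hc | hg
  · exact hc.completes (hs i).1 htr ht'.exact
  · exact hg ▸ ht'.completes_generating

theorem mem_generated_iff [IsLocalRing R] (hx : IsUniformizer x) (ha : IsAdmissible x a)
    {C : ProjCat} {t : Diagram R} :
    t ∈ Generated C x a ↔ t.IsTriangle C ∧ t.Saturated x a := by
  refine ⟨fun h => ⟨h.1, saturated_of_mem_generated hx ha h⟩, fun ⟨htr, ht⟩ => ?_⟩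
  obtain ⟨Z, v, w, hG⟩ := exists_mem_generated hx a htr.objX htr.objY t.u
  have hi := Completes.isIso (ht.completes_of_mem_generated hG htr)
    (saturated_of_mem_generated hx ha hG).exact ht.exact
  obtain ⟨-, ι, s, hι, hs, hts⟩ := hG
  exact ⟨htr, ι, s, hι, hs, hi.symm.trans hts⟩

theorem exact_neg_left {A B D : Type*} [AddCommGroup A] [AddCommGroup B] [AddCommGroup D]
    [Module R A] [Module R B] [Module R D] {b : A →ₗ[R] B} {c : B →ₗ[R] D} :
    Function.Exact (-b) c ↔ Function.Exact b c := by
  have h : Set.range (-b) = Set.range b := by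
    ext y
    constructor
    · rintro ⟨p, rfl⟩
      exact ⟨-p, map_neg b p⟩
    · rintro ⟨p, rfl⟩
      exact ⟨-p, by rw [LinearMap.neg_apply, map_neg, neg_neg]⟩
  simp only [Function.Exact, h]

theorem exact_neg_right {A B D : Type*} [AddCommGroup A] [AddCommGroup B] [AddCommGroup D]
    [Module R A] [Module R B] [Module R D] {b : A →ₗ[R] B} {c : B →ₗ[R] D} :
    Function.Exact b (-c) ↔ Function.Exact b c := by
  simp only [Function.Exact, LinearMap.neg_apply, neg_eq_zero]

theorem exact_translate_iff {t : Diagram R} : t.translate.Exact ↔ t.Exact :=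
  ⟨fun h => ⟨exact_neg_left.1 h.exact_wu, h.exact_uv, exact_neg_right.1 h.exact_vw⟩,
    fun h => ⟨h.exact_vw, exact_neg_right.2 h.exact_wu, exact_neg_left.2 h.exact_uv⟩⟩

/-- Saturated triangles are stable under translation. The sign in the translate disappears as the
residue skew field has characteristic two. -/
theorem Saturated.translate (hx : IsUniformizer x) (ha : IsAdmissible x a) {C : ProjCat}
    {t : Diagram R} (htr : t.IsTriangle C) (ht : t.Saturated x a) :
    t.translate.Saturated x a := by
  refine ⟨exact_translate_iff.2 ht.exact, fun (y : t.Y) (z : t.Z) (h : t.v y = x • z) => ?_⟩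
  have := htr.objZ.projective
  obtain ⟨p, hp⟩ := (ht.exact.exact_uv (x • y)).1 (by rw [map_smul, h, hx.smul_smul_self])
  obtain ⟨s, hs, hs'⟩ := ht.exists_extension p y hp
  obtain ⟨n, hn⟩ := hx.exists_eq_smul (y := s - z) (by rw [smul_sub, ← hs, h, sub_self])
  refine ⟨a • p - t.w n, ?_, ?_⟩
  · change t.w z = x • (a • p - t.w n)
    rw [smul_sub, ← map_smul, ← hn, smul_smul, ha.comm, ← hs', map_sub, sub_sub_cancel]
  · change -t.u (a • p - t.w n) = (a * x) • y
    rw [map_sub, htr.uw_apply, sub_zero, map_smul, hp, smul_smul, ← neg_smul,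
      ha.neg_mul hx]

theorem saturated_translate_iff (hx : IsUniformizer x) (ha : IsAdmissible x a) {C : ProjCat}
    {t : Diagram R} (htr : t.IsTriangle C) :
    t.translate.Saturated x a ↔ t.Saturated x a := by
  refine ⟨fun h => ⟨exact_translate_iff.1 h.exact, fun p q hpq => ?_⟩,
    Saturated.translate hx ha htr⟩
  -- The third translate of `t` is `t` with all signs reversed.
  obtain ⟨s, hs, hs'⟩ := ((h.translate hx ha htr.translate).translate hx ha
    htr.translate.translate).exists_extension p (-q : t.Y)
    (by change -t.u p = x • -q; rw [hpq, smul_neg])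
  obtain ⟨s, rfl⟩ : ∃ s' : t.Z, s' = s := ⟨s, rfl⟩
  change -t.v (-q) = x • s at hs
  change -t.w s = (a * x) • p at hs'
  exact ⟨s, by rw [← hs, map_neg, neg_neg],
    by rw [← ha.neg_mul hx, neg_smul, ← hs', neg_neg]⟩

end Diagram

end Saturated

/-! ### Homotopies and mapping cones -/

section Cones

variable {R : Type u} [Ring R] {x a : R}

namespace Diagram

/-- Homotopy of morphisms of triangles. -/
def Homotopic {t t' : Diagram R} (φ ψ : Hom t t') : Prop :=
  ∃ (Θ : t.Y →ₗ[R] t'.X) (Φ : t.Z →ₗ[R] t'.Y) (Ψ : t.X →ₗ[R] t'.Z),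
    (∀ p, φ.f p = ψ.f p + (Θ (t.u p) + t'.w (Ψ p))) ∧
    (∀ y, φ.g y = ψ.g y + (Φ (t.v y) + t'.u (Θ y))) ∧
    ∀ z, φ.h z = ψ.h z + (Ψ (t.w z) + t'.v (Φ z))

theorem Homotopic.refl {t t' : Diagram R} (φ : Hom t t') : Homotopic φ φ :=
  ⟨0, 0, 0, by simp, by simp, by simp⟩

theorem Homotopic.trans {t t' : Diagram R} {φ ψ χ : Hom t t'} (h : Homotopic φ ψ)
    (h' : Homotopic ψ χ) : Homotopic φ χ := by
  obtain ⟨Θ, Φ, Ψ, h1, h2, h3⟩ := h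
  obtain ⟨Θ', Φ', Ψ', h1', h2', h3'⟩ := h'
  refine ⟨Θ + Θ', Φ + Φ', Ψ + Ψ', fun p => ?_, fun y => ?_, fun z => ?_⟩
  · rw [h1, h1', LinearMap.add_apply, LinearMap.add_apply, map_add]; abel
  · rw [h2, h2', LinearMap.add_apply, LinearMap.add_apply, map_add]; abel
  · rw [h3, h3', LinearMap.add_apply, LinearMap.add_apply, map_add]; abel

theorem Homotopic.symm {t t' : Diagram R} {φ ψ : Hom t t'} (h : Homotopic φ ψ) :
    Homotopic ψ φ := by
  obtain ⟨Θ, Φ, Ψ, h1, h2, h3⟩ := h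
  refine ⟨-Θ, -Φ, -Ψ, fun p => ?_, fun y => ?_, fun z => ?_⟩
  · rw [h1, LinearMap.neg_apply, LinearMap.neg_apply, map_neg]; abel
  · rw [h2, LinearMap.neg_apply, LinearMap.neg_apply, map_neg]; abel
  · rw [h3, LinearMap.neg_apply, LinearMap.neg_apply, map_neg]; abel

theorem Homotopic.comp_left {t t' t'' : Diagram R} {φ ψ : Hom t t'} (h : Homotopic φ ψ)
    (χ : Hom t' t'') : Homotopic (χ.comp φ) (χ.comp ψ) := by
  obtain ⟨Θ, Φ, Ψ, h1, h2, h3⟩ := h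
  refine ⟨χ.f ∘ₗ Θ, χ.g ∘ₗ Φ, χ.h ∘ₗ Ψ, fun p => ?_, fun y => ?_, fun z => ?_⟩
  · simp [Hom.comp, h1, χ.w_apply]
  · simp [Hom.comp, h2, χ.u_apply]
  · simp [Hom.comp, h3, χ.v_apply]

theorem Homotopic.comp_right {t t' t'' : Diagram R} {φ ψ : Hom t' t''} (h : Homotopic φ ψ)
    (χ : Hom t t') : Homotopic (φ.comp χ) (ψ.comp χ) := by
  obtain ⟨Θ, Φ, Ψ, h1, h2, h3⟩ := h
  refine ⟨Θ ∘ₗ χ.g, Φ ∘ₗ χ.h, Ψ ∘ₗ χ.f, fun p => ?_, fun y => ?_, fun z => ?_⟩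
  · simp [Hom.comp, h1, χ.u_apply]
  · simp [Hom.comp, h2, χ.v_apply]
  · simp [Hom.comp, h3, χ.w_apply]

theorem bijective_shear {A B : Type*} [AddCommGroup A] [AddCommGroup B] [Module R A] [Module R B]
    (k : A →ₗ[R] B) : Function.Bijective
      (LinearMap.prod (LinearMap.fst R A B) (LinearMap.snd R A B + k ∘ₗ LinearMap.fst R A B)) := by
  constructor
  · rintro ⟨p, q⟩ ⟨p', q'⟩ h
    obtain rfl : p = p' := congrArg Prod.fst h
    have h2 : q + k p = q' + k p := congrArg Prod.snd h
    rw [add_right_cancel h2]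
  · rintro ⟨p, q⟩
    exact ⟨(p, q - k p), Prod.ext rfl (sub_add_cancel q (k p))⟩

/-- Homotopic morphisms have isomorphic mapping cones. -/
theorem Homotopic.isIso_cone {t t' : Diagram R} {φ ψ : Hom t t'} (h : Homotopic φ ψ) :
    IsIso φ.cone ψ.cone := by
  obtain ⟨Θ, Φ, Ψ, h1, h2, h3⟩ := h
  refine ⟨⟨LinearMap.prod (LinearMap.fst R t.Y t'.X)
      (LinearMap.snd R t.Y t'.X + Θ ∘ₗ LinearMap.fst R t.Y t'.X),
    LinearMap.prod (LinearMap.fst R t.Z t'.Y)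
      (LinearMap.snd R t.Z t'.Y + Φ ∘ₗ LinearMap.fst R t.Z t'.Y),
    LinearMap.prod (LinearMap.fst R t.X t'.Z)
      (LinearMap.snd R t.X t'.Z + Ψ ∘ₗ LinearMap.fst R t.X t'.Z), ?_, ?_, ?_⟩,
    bijective_shear Θ, bijective_shear Φ, bijective_shear Ψ⟩
  · refine LinearMap.ext fun ⟨y, p⟩ => ?_
    change (-t.v y, φ.g y + t'.u p + Φ (-t.v y)) = (-t.v y, ψ.g y + t'.u (p + Θ y))
    rw [h2, map_neg, map_add]
    congr 1
    abel
  · refine LinearMap.ext fun ⟨y, p⟩ => ?_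
    change (-t.w y, φ.h y + t'.v p + Ψ (-t.w y)) = (-t.w y, ψ.h y + t'.v (p + Φ y))
    rw [h3, map_neg, map_add]
    congr 1
    abel
  · refine LinearMap.ext fun ⟨y, p⟩ => ?_
    change (-t.u y, φ.f y + t'.w p + Θ (-t.u y)) = (-t.u y, ψ.f y + t'.w (p + Ψ y))
    rw [h1, map_neg, map_add]
    congr 1
    abel

theorem IsTriangle.cone {C : ProjCat} {t t' : Diagram R} (ht : t.IsTriangle C)
    (ht' : t'.IsTriangle C) (φ : Hom t t') : φ.cone.IsTriangle C where
  objX := ProjCat.isObj_prod ht.objY ht'.objX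
  objY := ProjCat.isObj_prod ht.objZ ht'.objY
  objZ := ProjCat.isObj_prod ht.objX ht'.objZ
  vu := LinearMap.ext fun ⟨y, p⟩ => by
    change (-t.w (-t.v y), φ.h (-t.v y) + t'.v (φ.g y + t'.u p)) = 0
    rw [map_neg, ht.wv_apply, map_neg, φ.v_apply, map_add, ht'.vu_apply]
    simp
  wv := LinearMap.ext fun ⟨y, p⟩ => by
    change (-t.u (-t.w y), φ.f (-t.w y) + t'.w (φ.h y + t'.v p)) = 0
    rw [map_neg, ht.uw_apply, map_neg, φ.w_apply, map_add, ht'.wv_apply]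
    simp
  uw := LinearMap.ext fun ⟨y, p⟩ => by
    change (-t.v (-t.u y), φ.g (-t.u y) + t'.u (φ.f y + t'.w p)) = 0
    rw [map_neg, ht.vu_apply, map_neg, φ.u_apply, map_add, ht'.uw_apply]
    simp

/-- The diagram chase behind exactness of a mapping cone, at one of its three vertices. -/
theorem exact_cone_aux {A B D A' B' D' : Type*} [AddCommGroup A] [AddCommGroup B]
    [AddCommGroup D] [AddCommGroup A'] [AddCommGroup B'] [AddCommGroup D']
    [Module R A] [Module R B] [Module R D] [Module R A'] [Module R B'] [Module R D']
    {b : A →ₗ[R] B} {c : B →ₗ[R] D} {b' : A' →ₗ[R] B'} {c' : B' →ₗ[R] D'}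
    {g : A →ₗ[R] B'} {h : B →ₗ[R] D'} (he : Function.Exact b c) (he' : Function.Exact b' c')
    (hgh : ∀ y, h (b y) = c' (g y)) {z : B} {y' : B'} (h1 : c z = 0) (h2 : h z + c' y' = 0) :
    ∃ y p, -b y = z ∧ g y + b' p = y' := by
  obtain ⟨y, rfl⟩ := (he z).1 h1
  obtain ⟨p, hp⟩ := (he' (y' + g y)).1 (by rw [map_add, ← hgh, add_comm, h2])
  exact ⟨-y, p, by rw [map_neg, neg_neg], by rw [map_neg, hp]; abel⟩

theorem Exact.cone {C : ProjCat} {t t' : Diagram R} (ht : t.IsTriangle C) (ht' : t'.IsTriangle C)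
    (h : t.Exact) (h' : t'.Exact) (φ : Hom t t') : φ.cone.Exact := by
  have hc := ht.cone ht' φ
  refine ⟨fun q => ⟨?_, ?_⟩, fun q => ⟨?_, ?_⟩, fun q => ⟨?_, ?_⟩⟩
  · obtain ⟨z, y'⟩ := q
    intro hq
    obtain ⟨y, p, h1, h2⟩ := exact_cone_aux h.exact_vw h'.exact_uv φ.v_apply
      (neg_eq_zero.1 (congrArg Prod.fst hq)) (congrArg Prod.snd hq)
    exact ⟨(y, p), Prod.ext h1 h2⟩
  · rintro ⟨p, rfl⟩
    exact hc.vu_apply p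
  · obtain ⟨z, y'⟩ := q
    intro hq
    obtain ⟨y, p, h1, h2⟩ := exact_cone_aux h.exact_wu h'.exact_vw φ.w_apply
      (neg_eq_zero.1 (congrArg Prod.fst hq)) (congrArg Prod.snd hq)
    exact ⟨(y, p), Prod.ext h1 h2⟩
  · rintro ⟨p, rfl⟩
    exact hc.wv_apply p
  · obtain ⟨z, y'⟩ := q
    intro hq
    obtain ⟨y, p, h1, h2⟩ := exact_cone_aux h.exact_uv h'.exact_wu φ.u_apply
      (neg_eq_zero.1 (congrArg Prod.fst hq)) (congrArg Prod.snd hq)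
    exact ⟨(y, p), Prod.ext h1 h2⟩
  · rintro ⟨p, rfl⟩
    exact hc.uw_apply p

/-- If `φ` is a split epimorphism `β` onto a triangle `s` followed by a split monomorphism `α`,
then its mapping cone is saturated: it is the sum of a translate of the kernel of `β`, of the
cokernel of `α`, and of the contractible mapping cone of the identity of `s`. -/
theorem Saturated.cone_comp (hx : IsUniformizer x) (ha : IsAdmissible x a) {C C' : ProjCat}
    {t t' s : Diagram R} (htr : t.IsTriangle C) (htr' : t'.IsTriangle C) (hsr : s.IsTriangle C')
    (ht : t.Saturated x a) (ht' : t'.Saturated x a)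
    {β : Hom t s} {β' : Hom s t} (hβ : β.comp β' = Hom.id s)
    {α : Hom s t'} {α' : Hom t' s} (hα : α'.comp α = Hom.id s) :
    (α.comp β).cone.Saturated x a := by
  refine ⟨Exact.cone htr htr' ht.exact ht'.exact _, ?_⟩
  rintro ⟨y, p'⟩ ⟨z, y'⟩ h
  have h1 : -t.v y = x • z := congrArg Prod.fst h
  have h2 : α.g (β.g y) + t'.u p' = x • y' := congrArg Prod.snd h
  simp only [Hom.comp, Hom.id, Hom.mk.injEq] at hβ hα
  have hβf : ∀ p, β.f (β'.f p) = p := LinearMap.congr_fun hβ.1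
  have hβg : ∀ p, β.g (β'.g p) = p := LinearMap.congr_fun hβ.2.1
  have hβh : ∀ p, β.h (β'.h p) = p := LinearMap.congr_fun hβ.2.2
  have hαf : ∀ p, α'.f (α.f p) = p := LinearMap.congr_fun hα.1
  have hαg : ∀ p, α'.g (α.g p) = p := LinearMap.congr_fun hα.2.1
  have hαh : ∀ p, α'.h (α.h p) = p := LinearMap.congr_fun hα.2.2
  have := hsr.objZ.projective
  -- The component in the translate of the kernel of `β`.
  have hk₀ : t.v (y - β'.g (β.g y)) = x • -(z - β'.h (β.h z)) := by
    have h3 : s.v (β.g y) = -(x • β.h z) := by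
      rw [← map_smul, ← h1, map_neg, neg_neg, β.v_apply]
    rw [map_sub, ← β'.v_apply, h3, map_neg, map_smul, smul_neg, smul_sub, ← h1]
    abel
  obtain ⟨k, hk, hk'⟩ := (ht.translate hx ha htr).exists_extension (y - β'.g (β.g y))
    (-(z - β'.h (β.h z))) hk₀
  obtain ⟨k, rfl⟩ : ∃ k' : t.X, k' = k := ⟨k, rfl⟩
  change t.w (-(z - β'.h (β.h z))) = x • k at hk
  change -t.u k = (a * x) • (y - β'.g (β.g y)) at hk'
  -- The component in the cokernel of `α`.
  obtain ⟨l, hl, hl'⟩ := ht'.exists_extension (p' - α.f (α'.f p')) (y' - α.g (α'.g y')) (by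
    have h3 : t'.u p' = x • y' - α.g (β.g y) := by rw [← h2]; abel
    rw [map_sub, ← α.u_apply, ← α'.u_apply, h3, map_sub, hαg, map_sub, map_smul, map_smul,
      smul_sub]
    abel)
  -- The component in the mapping cone of the identity of `s`.
  have h4 : β.g y + s.u (α'.f p') = x • α'.g y' := by
    rw [← map_smul, ← h2, map_add, hαg, α'.u_apply]
  have h5 : -s.v (β.g y) = x • β.h z := by rw [← β.v_apply, ← map_neg, h1, map_smul]
  obtain ⟨m, hm⟩ := hx.exists_eq_smul (y := β.h z + s.v (α'.g y')) (by
    rw [smul_add, ← h5, ← map_smul, ← h4, map_add, hsr.vu_apply, add_zero, neg_add_cancel])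
  have hm1 : x • s.w m = s.w (β.h z) := by
    rw [← map_smul, ← hm, map_add, hsr.wv_apply, add_zero]
  refine ⟨((k - β'.f (β.f k)) + β'.f ((a * x) • α'.f p' - s.w m), (l - α.h (α'.h l)) + α.h m),
    Prod.ext ?_ ?_, Prod.ext ?_ ?_⟩
  · change -t.w z = x • ((k - β'.f (β.f k)) + β'.f ((a * x) • α'.f p' - s.w m))
    have h6 : x • β.f k = 0 := by
      rw [← map_smul, ← hk, β.w_apply, map_neg, map_sub, hβh, sub_self, neg_zero, map_zero]
    rw [smul_add, smul_sub, ← map_smul β'.f x (β.f k), h6, map_zero, sub_zero, ← hk, ← map_smul,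
      smul_sub, hx.smul_mul_smul', hm1, zero_sub, map_neg, map_neg, β'.w_apply, map_sub]
    abel
  · change α.h (β.h z) + t'.v y' = x • ((l - α.h (α'.h l)) + α.h m)
    have h6 : x • α'.h l = 0 := by
      rw [← map_smul, ← hl, α'.v_apply, map_sub, hαg, sub_self, map_zero]
    rw [smul_add, smul_sub, ← map_smul α.h x (α'.h l), h6, map_zero, sub_zero, ← hl, ← map_smul,
      ← hm, map_add, map_sub, α.v_apply]
    abel
  · change -t.u ((k - β'.f (β.f k)) + β'.f ((a * x) • α'.f p' - s.w m)) = (a * x) • y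
    have h6 : s.u (β.f k) = 0 := by
      rw [← β.u_apply, ← neg_eq_zero, ← map_neg, hk', map_smul, map_sub, hβg, sub_self, smul_zero]
    have h7 : s.u (α'.f p') = x • α'.g y' - β.g y := by rw [← h4]; abel
    rw [map_add, map_sub, ← β'.u_apply, h6, map_zero, sub_zero, neg_add, hk', ← β'.u_apply,
      map_sub, map_smul, hsr.uw_apply, h7, sub_zero,
      smul_sub (a * x) (x • α'.g y'), hx.smul_mul_smul, zero_sub, map_neg, map_smul, smul_sub]
    abel
  · change α.f (β.f ((k - β'.f (β.f k)) + β'.f ((a * x) • α'.f p' - s.w m))) +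
      t'.w ((l - α.h (α'.h l)) + α.h m) = (a * x) • p'
    have h6 : s.w (α'.h l) = 0 := by
      rw [← α'.w_apply, hl', map_smul, map_sub, hαf, sub_self, smul_zero]
    rw [map_add β.f, map_sub β.f, hβf, sub_self, zero_add, hβf, map_sub, map_smul, map_add,
      map_sub, ← α.w_apply, h6, map_zero, sub_zero, hl', α.w_apply, smul_sub]
    abel

end Diagram

end Cones

/-! ### Minimal models and the mapping cone axiom -/

section Minimal

variable {R : Type u} [Ring R] {x a : R}

namespace Diagram

/-- A triangle of projective modules is minimal if its maps vanish modulo `𝔪`. This is expressed by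
saying that their images are killed by `x`, which is the same over projective modules. -/
structure Minimal (x : R) (t : Diagram R) : Prop where
  smul_u : ∀ p, x • t.u p = 0
  smul_v : ∀ y, x • t.v y = 0
  smul_w : ∀ z, x • t.w z = 0

theorem minimal_generating (hx : IsUniformizer x) : (generating x a).Minimal x where
  smul_u := fun r : R => by
    change x * (r * x) = 0
    rw [← mul_assoc, hx.mul_mul_eq_zero]
  smul_v := fun r : R => by
    change x * (r * x) = 0
    rw [← mul_assoc, hx.mul_mul_eq_zero]
  smul_w := fun r : R => by
    change x * (r * (a * x)) = 0
    rw [← mul_assoc r, ← mul_assoc, hx.mul_mul_eq_zero]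

theorem Minimal.directSum {ι : Type u} {s : ι → Diagram R} (hs : ∀ i, (s i).Minimal x) :
    (directSum s).Minimal x where
  smul_u := fun p : DirectSum ι fun i => (s i).X => DirectSum.ext fun i => (hs i).smul_u (p i)
  smul_v := fun p : DirectSum ι fun i => (s i).Y => DirectSum.ext fun i => (hs i).smul_v (p i)
  smul_w := fun p : DirectSum ι fun i => (s i).Z => DirectSum.ext fun i => (hs i).smul_w (p i)

/-- The direct sum of a family of morphisms of triangles. -/
noncomputable def Hom.directSum {ι : Type u} {s s' : ι → Diagram R} (φ : ∀ i, Hom (s i) (s' i)) :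
    Hom (directSum s) (directSum s') where
  f := DirectSum.lmap fun i => (φ i).f
  g := DirectSum.lmap fun i => (φ i).g
  h := DirectSum.lmap fun i => (φ i).h
  comm_u := LinearMap.ext fun p : DirectSum ι fun i => (s i).X =>
    DirectSum.ext fun i => (φ i).u_apply (p i)
  comm_v := LinearMap.ext fun p : DirectSum ι fun i => (s i).Y =>
    DirectSum.ext fun i => (φ i).v_apply (p i)
  comm_w := LinearMap.ext fun p : DirectSum ι fun i => (s i).Z =>
    DirectSum.ext fun i => (φ i).w_apply (p i)

/-- A minimal model of a triangle `t`: a minimal saturated triangle of projective modules that is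
a retract of `t` and homotopy equivalent to `t`. -/
structure MinimalModel (x a : R) (t : Diagram R) where
  /-- the underlying triangle of the model -/
  E : Diagram R
  isTriangle : E.IsTriangle .projective
  saturated : E.Saturated x a
  minimal : E.Minimal x
  /-- the inclusion of the model -/
  i : Hom E t
  /-- the retraction onto the model -/
  p : Hom t E
  p_comp_i : p.comp i = Hom.id E
  homotopic : Homotopic (i.comp p) (Hom.id t)

theorem nonempty_minimalModel_generating [IsLocalRing R] (hx : IsUniformizer x)
    (ha : IsAdmissible x a) : Nonempty (MinimalModel x a (generating x a)) :=
  ⟨⟨generating x a, isTriangle_generating hx _ a, saturated_generating hx ha,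
    minimal_generating hx, Hom.id _, Hom.id _, rfl, Homotopic.refl _⟩⟩

theorem Contractible.nonempty_minimalModel {t : Diagram R} (hc : t.Contractible) :
    Nonempty (MinimalModel x a t) := by
  obtain ⟨Θ, Φ, Ψ, h1, h2, h3⟩ := hc
  have hobj := ProjCat.isObj_punit (R := R) .projective
  have h0 : ∀ p q : PUnit.{u + 1}, p = q := fun _ _ => rfl
  let E : Diagram R := ⟨ModuleCat.of R PUnit.{u + 1}, ModuleCat.of R PUnit.{u + 1},
    ModuleCat.of R PUnit.{u + 1}, 0, 0, 0⟩
  have hexact : Function.Exact (0 : PUnit.{u + 1} →ₗ[R] PUnit.{u + 1})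
      (0 : PUnit.{u + 1} →ₗ[R] PUnit.{u + 1}) := fun _ => ⟨fun _ => ⟨0, rfl⟩, fun _ => rfl⟩
  refine ⟨⟨E, ⟨hobj, hobj, hobj, rfl, rfl, rfl⟩, ⟨⟨hexact, hexact, hexact⟩,
    fun p q _ => ⟨(0 : PUnit.{u + 1}), rfl, rfl⟩⟩, ⟨fun _ => rfl, fun _ => rfl, fun _ => rfl⟩,
    ⟨0, 0, 0, ?_, ?_, ?_⟩, ⟨0, 0, 0, ?_, ?_, ?_⟩, rfl, -Θ, -Φ, -Ψ, fun p => ?_, fun y => ?_,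
      fun z => ?_⟩⟩
  · rw [LinearMap.zero_comp, LinearMap.comp_zero]
  · rw [LinearMap.zero_comp, LinearMap.comp_zero]
  · rw [LinearMap.zero_comp, LinearMap.comp_zero]
  · rw [LinearMap.zero_comp, LinearMap.comp_zero]
  · rw [LinearMap.zero_comp, LinearMap.comp_zero]
  · rw [LinearMap.zero_comp, LinearMap.comp_zero]
  · have h := LinearMap.congr_fun h3 p
    change p = Θ (t.u p) + t.w (Ψ p) at h
    change (0 : t.X) = p + (-Θ (t.u p) + t.w (-Ψ p))
    rw [map_neg]
    nth_rw 1 [h]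
    abel
  · have h := LinearMap.congr_fun h1 y
    change y = Φ (t.v y) + t.u (Θ y) at h
    change (0 : t.Y) = y + (-Φ (t.v y) + t.u (-Θ y))
    rw [map_neg]
    nth_rw 1 [h]
    abel
  · have h := LinearMap.congr_fun h2 z
    change z = Ψ (t.w z) + t.v (Φ z) at h
    change (0 : t.Z) = z + (-Ψ (t.w z) + t.v (-Φ z))
    rw [map_neg]
    nth_rw 1 [h]
    abel

/-- The direct sum of a family of minimal models. -/
noncomputable def MinimalModel.directSum {ι : Type u} {s : ι → Diagram R}
    (m : ∀ i, MinimalModel x a (s i)) : MinimalModel x a (directSum s) where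
  E := Diagram.directSum fun i => (m i).E
  isTriangle := IsTriangle.directSum (C := .projective) trivial fun i => (m i).isTriangle
  saturated := Saturated.directSum fun i => (m i).saturated
  minimal := Minimal.directSum fun i => (m i).minimal
  i := Hom.directSum fun i => (m i).i
  p := Hom.directSum fun i => (m i).p
  p_comp_i := by
    have h := fun i => (m i).p_comp_i
    simp only [Hom.comp, Hom.id, Hom.mk.injEq] at h
    simp only [Hom.comp, Hom.id, Hom.mk.injEq]
    exact ⟨LinearMap.ext fun p : DirectSum ι fun i => (m i).E.X =>
        DirectSum.ext fun i => LinearMap.congr_fun (h i).1 (p i),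
      LinearMap.ext fun p : DirectSum ι fun i => (m i).E.Y =>
        DirectSum.ext fun i => LinearMap.congr_fun (h i).2.1 (p i),
      LinearMap.ext fun p : DirectSum ι fun i => (m i).E.Z =>
        DirectSum.ext fun i => LinearMap.congr_fun (h i).2.2 (p i)⟩
  homotopic := by
    choose Θ Φ Ψ h1 h2 h3 using fun i => (m i).homotopic
    exact ⟨DirectSum.lmap Θ, DirectSum.lmap Φ, DirectSum.lmap Ψ,
      fun p : DirectSum ι fun i => (s i).X => DirectSum.ext fun i => h1 i (p i),
      fun p : DirectSum ι fun i => (s i).Y => DirectSum.ext fun i => h2 i (p i),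
      fun p : DirectSum ι fun i => (s i).Z => DirectSum.ext fun i => h3 i (p i)⟩

theorem nonempty_minimalModel [IsLocalRing R] (hx : IsUniformizer x) (ha : IsAdmissible x a)
    {C : ProjCat} {t : Diagram R} (ht : t ∈ Generated C x a) :
    Nonempty (MinimalModel x a t) := by
  obtain ⟨-, ι, s, -, hs, φ, hf, hg, hh⟩ := ht
  have hm : ∀ i, Nonempty (MinimalModel x a (s i)) := fun i => by
    rcases (hs i).2 with hc | hgen
    · exact hc.nonempty_minimalModel
    · exact hgen ▸ nonempty_minimalModel_generating hx ha
  let m := MinimalModel.directSum fun i => (hm i).some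
  obtain ⟨ψ, h1, h2⟩ := exists_hom_inverse φ hf hg hh
  refine ⟨⟨m.E, m.isTriangle, m.saturated, m.minimal, ψ.comp m.i, m.p.comp φ, ?_, ?_⟩⟩
  · calc (m.p.comp φ).comp (ψ.comp m.i) = m.p.comp ((φ.comp ψ).comp m.i) := rfl
      _ = m.p.comp m.i := by rw [h2]; rfl
      _ = Hom.id m.E := m.p_comp_i
  · have h := (m.homotopic.comp_right φ).comp_left ψ
    have h3 : ψ.comp ((Hom.id (Diagram.directSum s)).comp φ) = Hom.id t := h1
    rw [h3] at h
    exact h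

/-- Modulo `𝔪`, every map of projective modules is a split epimorphism onto a free module followed
by a split monomorphism. -/
theorem exists_factorization_mod [IsLocalRing R] (hx : IsUniformizer x) {Y Y' : Type u}
    [AddCommGroup Y] [Module R Y] [Module.Projective R Y]
    [AddCommGroup Y'] [Module R Y'] [Module.Projective R Y'] (g : Y →ₗ[R] Y') :
    ∃ (W : Type u) (b : Y →ₗ[R] DirectSum W fun _ => R) (b' : (DirectSum W fun _ => R) →ₗ[R] Y)
      (c : (DirectSum W fun _ => R) →ₗ[R] Y') (c' : Y' →ₗ[R] DirectSum W fun _ => R),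
      b ∘ₗ b' = LinearMap.id ∧ c' ∘ₗ c = LinearMap.id ∧ ∀ y, x • g y = x • c (b y) := by
  classical
  obtain ⟨I, J, K, L, bX, bY, hI, hJ, hK⟩ := hx.exists_normalForm g
  let e : I → DirectSum I fun _ => R := fun i => DirectSum.lof R I (fun _ => R) i 1
  let b : Y →ₗ[R] DirectSum I fun _ => R := bX.constr ℕ (Sum.elim e 0)
  let c : (DirectSum I fun _ => R) →ₗ[R] Y' := DirectSum.toModule R I Y' fun i =>
    LinearMap.toSpanSingleton R Y' (bY (.inl i))
  refine ⟨I, b, DirectSum.toModule R I Y fun i => LinearMap.toSpanSingleton R Y (bX (.inl i)), c,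
    bY.constr ℕ (Sum.elim e 0), ?_, ?_, fun y => ?_⟩
  · ext i : 2
    simp [b, e]
  · ext i : 2
    simp [c, e]
  · have h : (hx.ann Y').mkQ ∘ₗ (g - c ∘ₗ b) = 0 := by
      refine bX.ext fun i => ?_
      rw [LinearMap.comp_apply, LinearMap.zero_apply, Submodule.mkQ_apply,
        Submodule.Quotient.mk_eq_zero, hx.mem_ann]
      rcases i with i | j | k
      · simp [b, c, e, hI]
      · simp [b, hJ, hx.smul_smul_self]
      · simp [b, hK]
    have h := LinearMap.congr_fun h y
    rw [LinearMap.comp_apply, LinearMap.zero_apply, Submodule.mkQ_apply,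
      Submodule.Quotient.mk_eq_zero, hx.mem_ann] at h
    rwa [← sub_eq_zero, ← smul_sub]

/-- Between minimal saturated triangles, every map of the middle objects extends to a morphism. -/
theorem exists_hom_of_minimal [IsLocalRing R] (hx : IsUniformizer x) (ha : IsAdmissible x a)
    {E E' : Diagram R} (htr : E.IsTriangle .projective) (hs : E.Saturated x a)
    (hm : E.Minimal x) (htr' : E'.IsTriangle .projective) (hs' : E'.Saturated x a)
    (hm' : E'.Minimal x) (g : E.Y →ₗ[R] E'.Y) : ∃ φ : Hom E E', φ.g = g := by
  have := htr.objX.projective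
  have := htr'.objY.projective
  obtain ⟨f, hf⟩ := exists_comp_eq_of_forall_mem_range E'.u (g ∘ₗ E.u) fun p => by
    obtain ⟨k, hk⟩ := hx.exists_eq_smul (y := g (E.u p))
      (by rw [← map_smul, hm.smul_u, map_zero])
    exact (hs'.exact.exact_uv _).1 (by rw [LinearMap.comp_apply, hk, map_smul, hm'.smul_v])
  obtain ⟨φ, -, hφ⟩ := hs'.completes_of_mem_generated
    ((mem_generated_iff hx ha).2 ⟨htr, hs⟩) htr' f g hf.symm
  exact ⟨φ, hφ⟩

/-- An endomorphism of a minimal saturated triangle that is the identity on the middle object is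
invertible. -/
theorem exists_inverse_of_minimal (hx : IsUniformizer x) {E : Diagram R}
    (htr : E.IsTriangle .projective) (hs : E.Saturated x a) (hm : E.Minimal x) (φ : Hom E E)
    (hφ : φ.g = LinearMap.id) :
    ∃ ψ : Hom E E, ψ.comp φ = Hom.id E ∧ ψ.g = LinearMap.id := by
  have := htr.objX.projective
  have := htr.objZ.projective
  have hf : Function.Bijective φ.f := hx.bijective_of_smul_eq _ fun p => by
    obtain ⟨z, hz⟩ := (hs.exact.exact_wu (φ.f p - p)).1
      (by rw [map_sub, ← φ.u_apply, hφ, LinearMap.id_apply, sub_self])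
    rw [← sub_eq_zero, ← smul_sub, ← hz, hm.smul_w]
  have hh : Function.Bijective φ.h := hx.bijective_of_smul_eq _ fun z => by
    obtain ⟨y, hy⟩ := (hs.exact.exact_vw (x • z)).1 (by rw [map_smul, hm.smul_w])
    rw [← map_smul, ← hy, φ.v_apply, hφ, LinearMap.id_apply]
  obtain ⟨ψ, hψ, -⟩ := exists_hom_inverse φ hf (hφ ▸ Function.bijective_id) hh
  refine ⟨ψ, hψ, ?_⟩
  have h := congrArg Hom.g hψ
  simpa [Hom.comp, Hom.id, hφ] using h

/-- A morphism between minimal saturated triangles can be changed in its last component so that it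
becomes homotopic to a split epimorphism followed by a split monomorphism. -/
theorem exists_homotopic_factorization [IsLocalRing R] (hx : IsUniformizer x)
    (ha : IsAdmissible x a) {E E' : Diagram R} (htr : E.IsTriangle .projective)
    (hs : E.Saturated x a) (hm : E.Minimal x) (htr' : E'.IsTriangle .projective)
    (hs' : E'.Saturated x a) (hm' : E'.Minimal x) (φ : Hom E E') :
    ∃ (s : Diagram R) (β : Hom E s) (β' : Hom s E) (α : Hom s E') (α' : Hom E' s)
      (χ : Hom E E'), s.IsTriangle .projective ∧ β.comp β' = Hom.id s ∧ α'.comp α = Hom.id s ∧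
      χ.f = φ.f ∧ χ.g = φ.g ∧ Homotopic χ (α.comp β) := by
  have := htr.objX.projective
  have := htr.objY.projective
  have := htr'.objY.projective
  obtain ⟨W, b, b', c, c', hb, hc, hg⟩ := exists_factorization_mod hx φ.g
  let s : Diagram R := directSum fun _ : W => generating x a
  have hst : s.IsTriangle .projective :=
    IsTriangle.directSum (C := .projective) trivial fun _ => isTriangle_generating hx _ a
  have hss : s.Saturated x a := Saturated.directSum fun _ => saturated_generating hx ha
  have hsm : s.Minimal x := Minimal.directSum fun _ => minimal_generating hx
  obtain ⟨β, rfl⟩ := exists_hom_of_minimal hx ha htr hs hm hst hss hsm b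
  obtain ⟨β', rfl⟩ := exists_hom_of_minimal hx ha hst hss hsm htr hs hm b'
  obtain ⟨α, rfl⟩ := exists_hom_of_minimal hx ha hst hss hsm htr' hs' hm' c
  obtain ⟨α', rfl⟩ := exists_hom_of_minimal hx ha htr' hs' hm' hst hss hsm c'
  obtain ⟨ψ, hψ, hψg⟩ := exists_inverse_of_minimal hx hst hss hsm (β.comp β') hb
  obtain ⟨ψ', hψ', -⟩ := exists_inverse_of_minimal hx hst hss hsm (α'.comp α) hc
  have hg' : ∀ y, x • φ.g y = x • (α.comp (ψ.comp β)).g y := fun y => by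
    rw [hg]
    change _ = x • α.g (ψ.g (β.g y))
    rw [hψg]
    rfl
  generalize hκ : α.comp (ψ.comp β) = κ at hg'
  obtain ⟨Θ, hΘ⟩ := exists_comp_eq_of_forall_mem_range E'.u (φ.g - κ.g) fun y => by
    obtain ⟨k, hk⟩ := hx.exists_eq_smul (y := (φ.g - κ.g) y)
      (by rw [LinearMap.sub_apply, smul_sub, hg', sub_self])
    exact (hs'.exact.exact_uv _).1 (by rw [hk, map_smul, hm'.smul_v])
  have hΘ : ∀ y, E'.u (Θ y) = φ.g y - κ.g y := LinearMap.congr_fun hΘ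
  obtain ⟨Ψ, hΨ⟩ := exists_comp_eq_of_forall_mem_range E'.w (φ.f - κ.f - Θ ∘ₗ E.u) fun p =>
    (hs'.exact.exact_wu _).1 (by
      rw [LinearMap.sub_apply, LinearMap.sub_apply, map_sub, map_sub, LinearMap.comp_apply, hΘ,
        φ.u_apply, κ.u_apply, sub_self])
  have hΨ : ∀ p, E'.w (Ψ p) = φ.f p - κ.f p - Θ (E.u p) := LinearMap.congr_fun hΨ
  refine ⟨s, ψ.comp β, β', α, ψ'.comp α', ⟨φ.f, φ.g, κ.h + Ψ ∘ₗ E.w, φ.comm_u, ?_, ?_⟩, hst, hψ,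
    hψ', rfl, rfl, Θ, 0, Ψ, fun p => ?_, fun y => ?_, fun z => ?_⟩
  · ext y
    have h : φ.g y = κ.g y + E'.u (Θ y) := by rw [hΘ]; abel
    simp [htr.wv_apply, κ.v_apply, h, htr'.vu_apply]
  · ext z
    have h := hΨ (E.w z)
    rw [htr.uw_apply, map_zero, sub_zero] at h
    simp [h, κ.w_apply]
  · rw [hκ]
    change φ.f p = _
    rw [hΨ]
    abel
  · rw [hκ]
    change φ.g y = _
    rw [hΘ, LinearMap.zero_apply]
    abel
  · rw [hκ]
    change κ.h z + Ψ (E.w z) = κ.h z + (Ψ (E.w z) + E'.v 0)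
    rw [map_zero, add_zero]

/-- The mapping cone axiom for the triangles generated by `x` and an admissible `a`. -/
theorem exists_cone_mem_generated [IsLocalRing R] (hx : IsUniformizer x) (ha : IsAdmissible x a)
    {C : ProjCat} {t t' : Diagram R} (ht : t ∈ Generated C x a) (ht' : t' ∈ Generated C x a)
    (f : t.X →ₗ[R] t'.X) (g : t.Y →ₗ[R] t'.Y) (hfg : g ∘ₗ t.u = t'.u ∘ₗ f) :
    ∃ φ : Hom t t', φ.f = f ∧ φ.g = g ∧ φ.cone ∈ Generated C x a := by
  have hs := saturated_of_mem_generated hx ha ht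
  have hs' := saturated_of_mem_generated hx ha ht'
  obtain ⟨φ, rfl, rfl⟩ := hs'.completes_of_mem_generated ht ht'.1 f g hfg
  obtain ⟨m⟩ := nonempty_minimalModel hx ha ht
  obtain ⟨m'⟩ := nonempty_minimalModel hx ha ht'
  obtain ⟨s, β, β', α, α', χ, hst, hβ, hα, hχf, hχg, hχ⟩ :=
    exists_homotopic_factorization hx ha m.isTriangle m.saturated m.minimal m'.isTriangle
      m'.saturated m'.minimal (m'.p.comp (φ.comp m.i))
  -- The last component of `φ` is changed so that `φ` induces `χ` on the minimal models.
  let δ : m.E.Z →ₗ[R] m'.E.Z := (m'.p.comp (φ.comp m.i)).h - χ.h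
  have hδv : ∀ y, δ (m.E.v y) = 0 := fun y => by
    rw [LinearMap.sub_apply, Hom.v_apply, Hom.v_apply, hχg, sub_self]
  have hδw : ∀ z, m'.E.w (δ z) = 0 := fun z => by
    rw [LinearMap.sub_apply, map_sub, ← Hom.w_apply, ← Hom.w_apply, hχf, sub_self]
  let φ' : Hom t t' :=
    { f := φ.f
      g := φ.g
      h := φ.h - m'.i.h ∘ₗ δ ∘ₗ m.p.h
      comm_u := φ.comm_u
      comm_v := LinearMap.ext fun y => by
        change φ.h (t.v y) - m'.i.h (δ (m.p.h (t.v y))) = t'.v (φ.g y)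
        rw [m.p.v_apply, hδv, map_zero, sub_zero, φ.v_apply]
      comm_w := LinearMap.ext fun z => by
        change φ.f (t.w z) = t'.w (φ.h z - m'.i.h (δ (m.p.h z)))
        rw [map_sub, ← m'.i.w_apply, hδw, map_zero, sub_zero, φ.w_apply] }
  have hpi : ∀ z, m.p.h (m.i.h z) = z := LinearMap.congr_fun (congrArg Hom.h m.p_comp_i)
  have hpi' : ∀ z, m'.p.h (m'.i.h z) = z := LinearMap.congr_fun (congrArg Hom.h m'.p_comp_i)
  have hφ'χ : m'.p.comp (φ'.comp m.i) = χ := by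
    refine Hom.eq_of_components hχf.symm hχg.symm (LinearMap.ext fun z => ?_)
    change m'.p.h (φ.h (m.i.h z) - m'.i.h (δ (m.p.h (m.i.h z)))) = χ.h z
    rw [hpi, map_sub, hpi']
    exact sub_sub_cancel _ _
  have h1 : Homotopic φ' ((m'.i.comp α).comp (β.comp m.p)) := by
    have h1 : Homotopic ((m'.i.comp m'.p).comp φ') φ' := m'.homotopic.comp_right φ'
    have h2 : Homotopic (((m'.i.comp m'.p).comp φ').comp (m.i.comp m.p))
        ((m'.i.comp m'.p).comp φ') := m.homotopic.comp_left _
    have h3 : Homotopic (m'.i.comp (χ.comp m.p)) (m'.i.comp ((α.comp β).comp m.p)) :=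
      (hχ.comp_right m.p).comp_left m'.i
    rw [← hφ'χ] at h3
    exact (h1.symm.trans h2.symm).trans h3
  refine ⟨φ', rfl, rfl, (mem_generated_iff hx ha).2 ⟨ht.1.cone ht'.1 φ',
    Saturated.of_isIso h1.isIso_cone (Saturated.cone_comp hx ha ht.1 ht'.1 hst hs hs'
      (β' := m.i.comp β') (α' := α'.comp m'.p) ?_ ?_)⟩⟩
  · calc (β.comp m.p).comp (m.i.comp β') = β.comp ((m.p.comp m.i).comp β') := rfl
      _ = β.comp β' := by rw [m.p_comp_i]; rfl
      _ = Hom.id s := hβ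
  · calc (α'.comp m'.p).comp (m'.i.comp α) = α'.comp ((m'.p.comp m'.i).comp α) := rfl
      _ = α'.comp α := by rw [m'.p_comp_i]; rfl
      _ = Hom.id s := hα

end Diagram

open Diagram

/-- The triangulation generated by `x` and an admissible element `a`. -/
def generatedTriangulation [IsLocalRing R] (hx : IsUniformizer x) (ha : IsAdmissible x a)
    (C : ProjCat) : Triangulation R C where
  dist := Generated C x a
  isTriangle t ht := ht.1
  iso_closed t ht t' ht' h := (mem_generated_iff hx ha).2
    ⟨ht', Saturated.of_isIso h.symm (saturated_of_mem_generated hx ha ht)⟩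
  identity_mem X hX := (mem_generated_iff hx ha).2
    ⟨isTriangle_identity hX, (contractible_identity X).saturated hx (isTriangle_identity hX)⟩
  exists_triangle X Y hX hY u := exists_mem_generated hx a hX hY u
  translate_mem_iff t ht := by
    rw [mem_generated_iff hx ha, mem_generated_iff hx ha, and_iff_right ht,
      and_iff_right ht.translate, saturated_translate_iff hx ha ht]
  exists_cone t ht t' ht' f g h := exists_cone_mem_generated hx ha ht ht' f g h

end Minimal

/-! ### Classification of the triangulations -/

theorem Triangulation.eq_of_isInducedBy {R : Type u} [Ring R] {x : R} {C : ProjCat}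
    {T T' : Triangulation R C} {r : ResidueSkewField R}
    (h : T.IsInducedBy x r) (h' : T'.IsInducedBy x r) : T = T' := by
  obtain ⟨a, rfl⟩ := residue_surjective r
  exact Triangulation.ext ((h.2 a rfl).trans (h'.2 a rfl).symm)

section Classification

variable {R : Type u} [Ring R] [IsLocalRing R] {x : R}

theorem isAdmissible_iff (hR : SquareZeroPrincipal R) (hx : x ∈ maxIdeal R) (hx0 : x ≠ 0) {a : R} :
    IsAdmissible x a ↔ (2 : R) ∈ maxIdeal R ∧ residue R a ≠ 0 ∧
      hR.sigma hx hx0 (residue R a) = residue R a ∧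
      ∀ t, residue R a * hR.sigma hx hx0 (hR.sigma hx hx0 (hR.sigma hx hx0 t)) =
        t * residue R a := by
  have hu := hR.isUniformizer hx hx0
  have heq : ∀ {s t : R}, s * x = t * x ↔ residue R s = residue R t := fun {s t} => by
    rw [residue_eq_iff, ← hu.mul_left_eq_zero_iff, sub_mul, sub_eq_zero]
  have key : (∀ f g h : R, x * g = f * x → x * h = g * x → a * x * f = h * (a * x)) ↔
      ∀ t, residue R a * hR.sigma hx hx0 (hR.sigma hx hx0 (hR.sigma hx hx0 t)) =
        t * residue R a := by
    have step : ∀ f g h k : R, x * g = f * x → x * h = g * x → x * f = k * x →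
        (a * x * f = h * (a * x) ↔
          residue R a * hR.sigma hx hx0 (hR.sigma hx hx0 (hR.sigma hx hx0 (residue R h))) =
            residue R h * residue R a) := by
      intro f g h k hg hh hf
      rw [hR.sigma_residue hx hx0 hh, hR.sigma_residue hx hx0 hg, hR.sigma_residue hx hx0 hf,
        ← map_mul, ← map_mul, ← heq, mul_assoc, hf, ← mul_assoc, ← mul_assoc]
    constructor
    · intro H t
      obtain ⟨h, rfl⟩ := residue_surjective t
      obtain ⟨g, hg⟩ := hR.exists_left hx hx0 h
      obtain ⟨f, hf⟩ := hR.exists_left hx hx0 g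
      obtain ⟨k, hk⟩ := hR.exists_left hx hx0 f
      exact (step f g h k hf hg hk).1 (H f g h hf hg)
    · intro H f g h hf hg
      obtain ⟨k, hk⟩ := hR.exists_left hx hx0 f
      exact (step f g h k hf hg hk).2 (H _)
  have key' : x * a = a * x ↔ hR.sigma hx hx0 (residue R a) = residue R a := by
    refine ⟨fun h => hR.sigma_residue hx hx0 h, fun h => ?_⟩
    obtain ⟨s, hs⟩ := hR.exists_left hx hx0 a
    rw [hR.sigma_residue hx hx0 hs] at h
    rw [hs, heq.2 h]
  rw [Ne, residue_eq_zero_iff, ← key, ← key']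
  exact ⟨fun h => ⟨h.two_mem, h.notMem, h.comm, h.twist⟩, fun h => ⟨h.2.1, h.1, h.2.2.1, h.2.2.2⟩⟩

namespace Triangulation

variable {C : ProjCat}

/-- When the residue skew field has characteristic two, `r` induces a triangulation if and only if
it is nonzero, fixed by `σ_x`, and satisfies `r σ_x³(t) = t r` for all `t`. -/
theorem exists_isInducedBy_iff (hR : SquareZeroPrincipal R) (hx : x ∈ maxIdeal R) (hx0 : x ≠ 0)
    (h2 : (2 : R) ∈ maxIdeal R) (C : ProjCat) (r : ResidueSkewField R) :
    (∃ T : Triangulation R C, T.IsInducedBy x r) ↔ r ≠ 0 ∧ hR.sigma hx hx0 r = r ∧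
      ∀ t, r * hR.sigma hx hx0 (hR.sigma hx hx0 (hR.sigma hx hx0 t)) = t * r := by
  have hu := hR.isUniformizer hx hx0
  obtain ⟨a, rfl⟩ := residue_surjective r
  have hiff := isAdmissible_iff hR hx hx0 (a := a)
  rw [and_iff_right h2] at hiff
  rw [← hiff]
  constructor
  · rintro ⟨T, hT⟩
    obtain ⟨ha, h⟩ := (T.isInducedBy_residue_iff hu).1 hT
    exact T.isAdmissible_of_generating_mem hu ha h
  · intro ha
    exact ⟨generatedTriangulation hu ha C, (isInducedBy_residue_iff _ hu).2
      ⟨ha.notMem, Diagram.generating_mem_generated hu C a⟩⟩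

/-- Sending a triangulation induced by `r` to `c r`, for a fixed `c ≠ 0`, is a bijection onto the
set of those `c r` for which `r` induces a triangulation. -/
theorem exists_equiv (hu : IsUniformizer x) (c : ResidueSkewField R) (hc : c ≠ 0)
    (P : ResidueSkewField R → Prop)
    (hP : ∀ r, (∃ T : Triangulation R C, T.IsInducedBy x r) ↔ P (c * r)) :
    ∃ φ : Triangulation R C ≃ {z : ResidueSkewField R // P z},
      ∀ (T : Triangulation R C) (r : ResidueSkewField R),
        T.IsInducedBy x r → (φ T : ResidueSkewField R) = c * r := by
  choose ρ hρ hρ' using fun T : Triangulation R C => T.existsUnique_isInducedBy hu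
  refine ⟨Equiv.ofBijective (fun T => ⟨c * ρ T, (hP _).1 ⟨T, hρ T⟩⟩) ⟨fun T T' h => ?_,
    fun ⟨z, hz⟩ => ?_⟩, fun T r hr => ?_⟩
  · have h1 : ρ T = ρ T' := mul_left_cancel₀ hc (congrArg Subtype.val h)
    exact eq_of_isInducedBy (hρ T) (h1 ▸ hρ T')
  · obtain ⟨T, hT⟩ := (hP (c⁻¹ * z)).2 (by rwa [mul_inv_cancel_left₀ hc])
    refine ⟨T, Subtype.ext ?_⟩
    change c * ρ T = z
    rw [← hρ' T _ hT, mul_inv_cancel_left₀ hc]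
  · change c * ρ T = c * r
    rw [hρ' T r hr]

end Triangulation

end Classification

end ProjTri

theorem mainTheorem3 (R : Type u) [Ring R] [IsLocalRing R] (hR : SquareZeroPrincipal R)
    (hm : maxIdeal R ≠ ⊥) (C : ProjCat) :
    -- every triangulation is `Δ^r` for exactly one `r`, for every generator `x`
    (∀ x ∈ maxIdeal R, x ≠ 0 → ∀ T : Triangulation R C,
      ∃! r : ResidueSkewField R, T.IsInducedBy x r) ∧
    -- mixed-characteristic case
    ((maxIdeal R : Set R) = {y | ∃ a, y = 2 * a} →
      ∃ φ : Triangulation R C ≃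
          {z : ResidueSkewField R // z ∈ Subring.center (ResidueSkewField R) ∧ z ≠ 0},
        ∀ (T : Triangulation R C) (r : ResidueSkewField R),
          T.IsInducedBy 2 r → (φ T : ResidueSkewField R) = r) ∧
    -- equicharacteristic case
    ((2 : R) = 0 → ∀ (x : R) (hx : x ∈ maxIdeal R) (hx0 : x ≠ 0)
      (T₀ : Triangulation R C) (r₀ : ResidueSkewField R), T₀.IsInducedBy x r₀ →
      ∃ φ : Triangulation R C ≃
          {z : ResidueSkewField R // z ∈ Subring.center (ResidueSkewField R) ∧
            hR.sigma hx hx0 z = z ∧ z ≠ 0},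
        ∀ (T : Triangulation R C) (r : ResidueSkewField R),
          T.IsInducedBy x r → (φ T : ResidueSkewField R) = r₀⁻¹ * r) := by
  refine ⟨fun x hx hx0 T => T.existsUnique_isInducedBy (hR.isUniformizer hx hx0), fun h2 => ?_,
    fun h2 x hx hx0 T₀ r₀ h₀ => ?_⟩
  · have hmem : (2 : R) ∈ maxIdeal R := by
      have h : (2 : R) ∈ (maxIdeal R : Set R) := h2 ▸ ⟨1, (mul_one 2).symm⟩
      exact h
    have hne : (2 : R) ≠ 0 := fun h0 => hm <| (Submodule.eq_bot_iff _).2 fun y hy => by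
      have hy' : y ∈ (maxIdeal R : Set R) := hy
      rw [h2] at hy'
      obtain ⟨b, rfl⟩ := hy'
      rw [h0, zero_mul]
    -- The element `2` is central, so its twist is trivial.
    have hσ : ∀ t, hR.sigma hmem hne t = t := fun t => by
      obtain ⟨t, rfl⟩ := residue_surjective t
      exact hR.sigma_residue hmem hne (by rw [two_mul, mul_two])
    obtain ⟨φ, hφ⟩ := Triangulation.exists_equiv (C := C) (hR.isUniformizer hmem hne) 1 one_ne_zero
      (fun z => z ∈ Subring.center (ResidueSkewField R) ∧ z ≠ 0) (fun r => by
        rw [Triangulation.exists_isInducedBy_iff hR hmem hne hmem, one_mul,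
          Subring.mem_center_iff]
        simp only [hσ]
        exact ⟨fun h => ⟨fun t => (h.2.2 t).symm, h.1⟩,
          fun h => ⟨h.2, trivial, fun t => (h.1 t).symm⟩⟩)
    exact ⟨φ, fun T r hr => (hφ T r hr).trans (one_mul r)⟩
  · have hmem : (2 : R) ∈ maxIdeal R := h2 ▸ zero_mem _
    have hiff := Triangulation.exists_isInducedBy_iff hR hx hx0 hmem C
    obtain ⟨hr₀, hσ₀, ht₀⟩ := (hiff r₀).1 ⟨T₀, h₀⟩
    refine Triangulation.exists_equiv (hR.isUniformizer hx hx0) r₀⁻¹ (inv_ne_zero hr₀)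
      (fun z => z ∈ Subring.center (ResidueSkewField R) ∧ hR.sigma hx hx0 z = z ∧ z ≠ 0)
      fun r => ?_
    obtain ⟨z, rfl⟩ : ∃ z, r = r₀ * z := ⟨r₀⁻¹ * r, (mul_inv_cancel_left₀ hr₀ r).symm⟩
    rw [hiff, inv_mul_cancel_left₀ hr₀, Subring.mem_center_iff, map_mul, hσ₀, mul_ne_zero_iff,
      and_iff_right hr₀, mul_right_inj' hr₀]
    -- As `t r₀ = r₀ τ` with `τ = σ_x³(t)`, the condition on `r₀ z` says that `z` commutes with `τ`.
    have hcomm : (∀ t, r₀ * z * hR.sigma hx hx0 (hR.sigma hx hx0 (hR.sigma hx hx0 t)) =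
        t * (r₀ * z)) ↔ ∀ g, g * z = z * g := by
      constructor
      · intro H g
        obtain ⟨t, rfl⟩ := (hR.sigma hx hx0).surjective g
        obtain ⟨t, rfl⟩ := (hR.sigma hx hx0).surjective t
        obtain ⟨t, rfl⟩ := (hR.sigma hx hx0).surjective t
        have h := H t
        rw [← mul_assoc t, ← ht₀, mul_assoc, mul_assoc] at h
        exact (mul_left_cancel₀ hr₀ h).symm
      · intro H t
        rw [← mul_assoc t, ← ht₀, mul_assoc, mul_assoc, H]
    rw [hcomm]
    exact ⟨fun h => ⟨h.2.2, h.2.1, h.1⟩, fun h => ⟨h.2.2, h.2.1, h.1⟩⟩
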